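/- A $3$-colored path is a finite path graph $P$ (its vertices can be listed as $v_1,\dots,v_n$ so that the edges are exactly the pairs $v_iv_{i+1}$, $1\le i<n$) together with an assignment of one of the three colors $0,1,2$ to each vertex; adjacent vertices may have the same color. A $3$-colored point set is a finite set $S$ of distinct points of the plane together with an assignment of one of the colors $0,1,2$ to each point; it is compatible with $P$ if, for each color $i$, the number of points of $S$ of color $i$ equals the number of vertices of $P$ of color $i$. A $3$-colored point-set embedding of $P$ on $S$ is a planar drawing of $P$ in which the vertices are mapped to distinct points of $S$, each vertex to a point of its own color, and each edge is drawn as a simple polyline joining the points of its two end-vertices, such that no edge passes through a vertex other than its end-vertices and two distinct edges meet at most in a common end-vertex. A bend of an edge is a point shared by two consecutive segments of its polyline, and the curve complexity of the embedding is the maximum number of bends along an edge. Theorem. Every $3$-colored path admits a $3$-colored point-set embedding with curve complexity at most $5$ on any compatible $3$-colored point set. -/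

import Mathlib

namespace PointSetEmbedding

/-- The plane (only its real affine structure is used). -/
abbrev Plane : Type := ℝ × ℝ

/-- A polyline, given by its first end, its interior corner points (the bends) in order,
and its last end.  With `m` bends it consists of `m + 1` segments. -/
structure Polyline where
  source : Plane
  bends : List Plane
  target : Plane

namespace Polyline

/-- The corner points of a polyline in order, both ends included. -/
def corners (l : Polyline) : List Plane :=
  l.source :: (l.bends ++ [l.target])

/-- The `i`-th segment of a polyline, from its `i`-th to its `(i+1)`-st corner. -/
def seg (l : Polyline) (i : ℕ) (hi : i + 1 < l.corners.length) : Set Plane :=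
  segment ℝ (l.corners[i]) (l.corners[i + 1])

/-- The set of points of the plane covered by a polyline. -/
def carrier (l : Polyline) : Set Plane :=
  {x | ∃ (i : ℕ) (hi : i + 1 < l.corners.length), x ∈ l.seg i hi}

/-- A polyline is simple if it is a simple Jordan arc, i.e. none of its segments is reduced to a
point, two consecutive segments meet only in the corner they share, and two non-consecutive
segments are disjoint. -/
structure IsSimple (l : Polyline) : Prop where
  nondegenerate : ∀ (i : ℕ) (hi : i + 1 < l.corners.length), l.corners[i] ≠ l.corners[i + 1]
  inter : ∀ (i j : ℕ) (hi : i + 1 < l.corners.length) (hj : j + 1 < l.corners.length), i < j →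
    ∀ x ∈ l.seg i hi, x ∈ l.seg j hj → j = i + 1 ∧ x = l.corners[j]

end Polyline

/-- A planar drawing of a graph in which every edge is a polyline: distinct vertices are distinct
points; every edge is a simple polyline joining the points of its two end-vertices; no edge
passes through a vertex that is not one of its end-vertices; and two distinct edges have no point
in common except a common end-vertex. -/
structure PlanarPolylineDrawing {V : Type*} (G : SimpleGraph V) where
  pos : V → Plane
  curve : G.edgeSet → Polyline
  pos_injective : Function.Injective pos
  curve_ends : ∀ e : G.edgeSet, ∃ u v : V, (e : Sym2 V) = s(u, v) ∧
    (curve e).source = pos u ∧ (curve e).target = pos v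
  curve_simple : ∀ e : G.edgeSet, (curve e).IsSimple
  mem_of_pos_mem_carrier : ∀ (e : G.edgeSet) (v : V), pos v ∈ (curve e).carrier → v ∈ (e : Sym2 V)
  inter : ∀ e f : G.edgeSet, e ≠ f → ∀ x ∈ (curve e).carrier, x ∈ (curve f).carrier →
    ∃ v : V, v ∈ (e : Sym2 V) ∧ v ∈ (f : Sym2 V) ∧ x = pos v

/-- The curve complexity: the maximum number of bends along an edge (`0` without edges). -/
noncomputable def PlanarPolylineDrawing.curveComplexity {V : Type*} {G : SimpleGraph V}
    (D : PlanarPolylineDrawing G) : ℕ∞ :=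
  ⨆ e : G.edgeSet, ((D.curve e).bends.length : ℕ∞)

/-- A `k`-colored point set: a finite set of points of the plane, each with one of `k` colors. -/
structure ColoredPointSet (k : ℕ) where
  points : Finset Plane
  col : points → Fin k

/-- A `k`-colored point set is compatible with a vertex coloring (not necessarily proper) if every
color is used for as many points as vertices. -/
def ColoredPointSet.Compatible {k : ℕ} {V : Type*} [Fintype V] (S : ColoredPointSet k)
    (c : V → Fin k) : Prop :=
  ∀ i : Fin k, (Finset.univ.filter fun p : S.points => S.col p = i).card =
    (Finset.univ.filter fun v : V => c v = i).card

/-- The planar polyline drawing `D` of a graph with vertex coloring `c` is a `k`-colored point-set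
embedding on `S`: every vertex lies on a point of `S` of the same color. (Distinct vertices lie
on distinct points by `pos_injective`.) -/
def PlanarPolylineDrawing.IsColoredEmbedding {k : ℕ} {V : Type*} {G : SimpleGraph V}
    (D : PlanarPolylineDrawing G) (c : V → Fin k) (S : ColoredPointSet k) : Prop :=
  ∀ v : V, ∃ h : D.pos v ∈ S.points, S.col ⟨D.pos v, h⟩ = c v

/-- A graph is a path if it is isomorphic to the path graph on some number of vertices. -/
def IsPathGraph {V : Type*} (G : SimpleGraph V) : Prop :=
  ∃ n : ℕ, Nonempty (SimpleGraph.pathGraph n ≃g G)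

end PointSetEmbedding

/-!
The colors `0` and `1` are assigned to the upper half-plane (the top page) and color `2` to the
lower half-plane (the bottom page); the points are sorted along a line, the axis.

The drawing comes from noncrossing matchings of vertices with points of the same color. Interlace
the path and the sequence of points on the axis in such a way that the `k`-th vertex and the `k`-th
point of the top page meet, for all `k`. For color `2` any noncrossing matching of vertices with
points serves, as only this color uses the bottom page. The top page has to accommodate two colors.
This works because both words are read in lockstep: every index at which the two words differ
has one of only two kinds, `0` against `1` or `1` against `0`, both kinds are equally frequent, and
a noncrossing matching of indices of opposite kinds matches the letters
(`exists_lockstep_matching`).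

Now let the path run along the axis from left to right and pull each of its vertices along its
matching arc to its point. An edge then consists of three arcs, the middle one of which passes below
the point of the top page that the path meets there, and arcs on the same page do not interleave
(`site_spec`, `exists_nonInterleaved_sites`). If every arc is drawn with one bend, an edge has three
bends on its arcs and two on the axis.

For points on a line, arcs with two segments whose height is the square of their width are disjoint
unless they interleave, so the whole path becomes one simple polyline
(`separatedPolyline_arcCorner`). Any two of its segments are strictly separated by a line, at their
common corner if they have one. This is an open condition on the corners
(`SeparatedPolyline.eventually`), so the drawing survives if the points leave the axis by a little,
and a linear map takes the given points to points that are as close to the axis as desired.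
-/

namespace PointSetEmbedding

open Filter Topology

/-! ### Noncrossing matchings -/

/-- The pairs `{p, q}` and `{r, s}` do not interleave: two arcs on the same side of a line, one with
ends `p`, `q` and one with ends `r`, `s`, need not cross. Common ends are allowed. -/
def NonInterleaved {α : Type*} [LinearOrder α] (p q r s : α) : Prop :=
  ¬ (min p q < min r s ∧ min r s < max p q ∧ max p q < max r s) ∧
  ¬ (min r s < min p q ∧ min p q < max r s ∧ max r s < max p q)

lemma NonInterleaved.map_strictMono {α β : Type*} [LinearOrder α] [LinearOrder β] {g : α → β}
    {p q r s : α} (h : NonInterleaved p q r s) (hg : StrictMono g) :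
    NonInterleaved (g p) (g q) (g r) (g s) := by
  unfold NonInterleaved at *
  simpa only [← hg.monotone.map_min, ← hg.monotone.map_max, hg.lt_iff_lt] using h

lemma nonInterleaved_comm {α : Type*} [LinearOrder α] {p q r s : α} :
    NonInterleaved p q r s ↔ NonInterleaved r s p q := by
  unfold NonInterleaved; exact and_comm

lemma nonInterleaved_swap_left {α : Type*} [LinearOrder α] {p q r s : α} :
    NonInterleaved p q r s ↔ NonInterleaved q p r s := by
  unfold NonInterleaved; rw [min_comm p q, max_comm p q]

lemma nonInterleaved_swap_right {α : Type*} [LinearOrder α] {p q r s : α} :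
    NonInterleaved p q r s ↔ NonInterleaved p q s r := by
  unfold NonInterleaved; rw [min_comm r s, max_comm r s]

/-- Of a nonempty set of signs with sum zero, two opposite ones are neighbors. -/
lemma exists_adjacent_opposite {α : Type*} [LinearOrder α] (s : Finset α) (f : α → ℤ)
    (hs : s.Nonempty) (hf : ∀ i ∈ s, f i = 1 ∨ f i = -1) (hsum : ∑ i ∈ s, f i = 0) :
    ∃ i ∈ s, ∃ j ∈ s, i < j ∧ f j = -f i ∧ ∀ k ∈ s, i < k → j ≤ k := by
  obtain ⟨m, hms, hmin⟩ := s.exists_min_image id hs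
  have hex : (s.filter fun j => f j ≠ f m).Nonempty := by
    by_contra hne
    rw [Finset.not_nonempty_iff_eq_empty, Finset.filter_eq_empty_iff] at hne
    have h1 : ∑ i ∈ s, f i = ∑ i ∈ s, f m :=
      Finset.sum_congr rfl fun i hi => not_not.1 (hne hi)
    rw [hsum, Finset.sum_const, nsmul_eq_mul] at h1
    have h2 : (s.card : ℤ) ≠ 0 := by exact_mod_cast hs.card_pos.ne'
    rcases hf m hms with h | h <;> rw [h] at h1 <;> omega
  obtain ⟨j, hj, hjmin⟩ := Finset.exists_min_image _ id hex
  obtain ⟨hjs, hjm⟩ := Finset.mem_filter.1 hj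
  have hmj : m < j := lt_of_le_of_ne (hmin j hjs) (by rintro rfl; exact hjm rfl)
  obtain ⟨i, hi, himax⟩ := Finset.exists_max_image (s.filter fun i => i < j) id
    ⟨m, Finset.mem_filter.2 ⟨hms, hmj⟩⟩
  obtain ⟨his, hij⟩ := Finset.mem_filter.1 hi
  have hfi : f i = f m := by
    by_contra h
    exact absurd (hjmin i (Finset.mem_filter.2 ⟨his, h⟩)) (not_le.2 hij)
  refine ⟨i, his, j, hjs, hij, ?_, fun k hk hik => ?_⟩
  · have h1 := hf m hms
    have h2 := hf j hjs
    omega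
  · by_contra h
    exact absurd (himax k (Finset.mem_filter.2 ⟨hk, not_le.1 h⟩)) (not_le.2 hik)

/-- Signs with sum zero have a noncrossing perfect matching of the positive with the negative ones,
here an involution `M`: match two opposite neighbors, remove them, and go on with the others. -/
theorem exists_nonInterleaved_matching {α : Type*} [LinearOrder α] (s : Finset α) (f : α → ℤ)
    (hf : ∀ i ∈ s, f i = 1 ∨ f i = -1) (hsum : ∑ i ∈ s, f i = 0) :
    ∃ M : α → α, (∀ i ∈ s, M i ∈ s ∧ M (M i) = i ∧ f (M i) = -f i) ∧
      ∀ i ∈ s, ∀ j ∈ s, i < j → j < M i → i < M j ∧ M j < M i := by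
  induction hn : s.card using Nat.strong_induction_on generalizing s with
  | _ n ih =>
  rcases s.eq_empty_or_nonempty with rfl | hs
  · exact ⟨id, by simp, by simp⟩
  obtain ⟨i, his, j, hjs, hij, hfij, hadj⟩ := exists_adjacent_opposite s f hs hf hsum
  have hji : j ∈ s.erase i := Finset.mem_erase.2 ⟨hij.ne', hjs⟩
  have hmem : ∀ x, x ∈ (s.erase i).erase j ↔ x ≠ j ∧ x ≠ i ∧ x ∈ s := by simp
  have hsum' : ∑ x ∈ (s.erase i).erase j, f x = 0 := by
    have h1 := Finset.sum_erase_add s f his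
    have h2 := Finset.sum_erase_add (s.erase i) f hji
    omega
  have hcard : ((s.erase i).erase j).card < n := by
    rw [← hn]
    exact lt_of_lt_of_le (Finset.card_erase_lt_of_mem hji) (Finset.card_erase_le)
  obtain ⟨M, hM, hN⟩ := ih _ hcard _ (fun x hx => hf x ((hmem x).1 hx).2.2) hsum' rfl
  refine ⟨fun x => if x = i then j else if x = j then i else M x, fun x hx => ?_,
    fun x hx y hy hxy hyx => ?_⟩
  · by_cases h1 : x = i
    · subst h1; simp [hij.ne', hjs, hfij]
    by_cases h2 : x = j
    · subst h2; simp [h1, his, hfij]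
    have h3 := hM x ((hmem x).2 ⟨h2, h1, hx⟩)
    have h4 := (hmem _).1 h3.1
    simp [h1, h2, h4, h3]
  · have key : ∀ x ∈ s, x ≠ i → x ≠ j → x < i ∨ j < x := fun x hx h1 h2 => by
      rcases lt_or_gt_of_ne h1 with h | h
      · exact Or.inl h
      · exact Or.inr (lt_of_le_of_ne (hadj x hx h) (Ne.symm h2))
    by_cases h1 : x = i
    · subst h1
      simp only [if_true] at hyx
      exact absurd (hadj y hy hxy) (not_le.2 hyx)
    by_cases h2 : x = j
    · subst h2
      simp only [h1, if_false, if_true] at hyx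
      exact absurd (hxy.trans hyx) (not_lt.2 hij.le)
    have h3 := hM x ((hmem x).2 ⟨h2, h1, hx⟩)
    have h4 := (hmem _).1 h3.1
    simp only [h1, h2, if_false] at hyx ⊢
    by_cases h5 : y = i
    · subst h5
      rcases key _ h4.2.2 h4.2.1 h4.1 with h | h
      · exact absurd hyx (not_lt.2 h.le)
      · simp [h, hxy.trans hij]
    by_cases h6 : y = j
    · subst h6
      rcases key _ hx h1 h2 with h | h
      · simp [h5, h, hij.trans hyx]
      · exact absurd hxy (not_lt.2 h.le)
    simp only [h5, h6, if_false]
    exact hN x ((hmem x).2 ⟨h2, h1, hx⟩) y ((hmem y).2 ⟨h6, h5, hy⟩) hxy hyx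

lemma nonInterleaved_of_involution {α : Type*} [LinearOrder α] {s : Finset α} {M : α → α}
    (hM : ∀ i ∈ s, M i ∈ s ∧ M (M i) = i)
    (hN : ∀ i ∈ s, ∀ j ∈ s, i < j → j < M i → i < M j ∧ M j < M i) {i j : α}
    (hi : i ∈ s) (hj : j ∈ s) : NonInterleaved i (M i) j (M j) := by
  have aux : ∀ i ∈ s, ∀ j ∈ s,
      ¬ (min i (M i) < min j (M j) ∧ min j (M j) < max i (M i) ∧
        max i (M i) < max j (M j)) := by
    intro i hi j hj ⟨h1, h2, h3⟩
    obtain ⟨hi1, hi2⟩ := hM i hi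
    obtain ⟨hj1, hj2⟩ := hM j hj
    rcases le_total i (M i) with h | h <;> rcases le_total j (M j) with h' | h' <;>
      simp only [min_eq_left h, min_eq_right h, max_eq_left h, max_eq_right h, min_eq_left h',
        min_eq_right h', max_eq_left h', max_eq_right h'] at h1 h2 h3
    · exact lt_asymm h3 (hN i hi j hj h1 h2).2
    · have := (hN i hi (M j) hj1 h1 h2).2
      rw [hj2] at this; exact lt_asymm h3 this
    · have := (hN (M i) hi1 j hj h1 (by rwa [hi2])).2
      rw [hi2] at this; exact lt_asymm h3 this
    · have := (hN (M i) hi1 (M j) hj1 h1 (by rwa [hi2])).2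
      rw [hi2, hj2] at this; exact lt_asymm h3 this
  exact ⟨aux i hi j hj, aux j hj i hi⟩

/-- Two disjoint sets of the same size on a line are matched without crossings. -/
lemma exists_nonInterleaved_bijection {α : Type*} [LinearOrder α] (A B : Finset α)
    (hAB : Disjoint A B) (hcard : A.card = B.card) :
    ∃ M : α → α, (∀ i ∈ A, M i ∈ B) ∧ Set.InjOn M A ∧
      ∀ i ∈ A, ∀ j ∈ A, NonInterleaved i (M i) j (M j) := by
  classical
  obtain ⟨M, hM, hN⟩ := exists_nonInterleaved_matching (A ∪ B)
    (fun i => if i ∈ A then 1 else -1) (fun i _ => by split_ifs <;> simp) (by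
      rw [Finset.sum_union hAB, Finset.sum_congr rfl (g := fun _ => (1 : ℤ)) (by simp_all),
        Finset.sum_congr (s₁ := B) rfl (g := fun _ => (-1 : ℤ))
          (fun x hx => if_neg (Finset.disjoint_right.1 hAB hx))]
      simp [hcard])
  refine ⟨M, fun i hi => ?_, fun i hi j hj hij => ?_, fun i hi j hj => ?_⟩
  · obtain ⟨h1, -, h2⟩ := hM i (Finset.mem_union_left _ hi)
    rw [if_pos hi] at h2
    rcases Finset.mem_union.1 h1 with h | h
    · rw [if_pos h] at h2; norm_num at h2
    · exact h
  · rw [← (hM i (Finset.mem_union_left _ hi)).2.1, hij,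
      (hM j (Finset.mem_union_left _ hj)).2.1]
  · exact nonInterleaved_of_involution (fun i hi => ⟨(hM i hi).1, (hM i hi).2.1⟩) hN
      (Finset.mem_union_left _ hi) (Finset.mem_union_left _ hj)

/-- Two words `V`, `U` over a two-letter alphabet with the same number of occurrences of each letter
can be matched letter by letter without crossings when they are interlaced on a line as
`V 0, U 0, V 1, U 1, …`. An index with `V k ≠ U k` carries a sign, according to which letter is in
`V`; matching opposite signs `k` and `l` without crossings, one may join `V k` to `U l` and `V l` to
`U k`. -/
theorem exists_lockstep_matching (N : ℕ) (V U : ℕ → Bool)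
    (h : ((Finset.range N).filter fun k => V k).card =
      ((Finset.range N).filter fun k => U k).card) :
    ∃ ρ : ℕ → ℕ, (∀ k < N, ρ k < N ∧ ρ (ρ k) = k ∧ U (ρ k) = V k ∧ (V k = U k → ρ k = k)) ∧
      ∀ k < N, ∀ l < N, k ≠ l →
        NonInterleaved (2 * k) (2 * ρ k + 1) (2 * l) (2 * ρ l + 1) := by
  set s := (Finset.range N).filter fun k => V k ≠ U k with hs
  have hmem : ∀ k, k ∈ s ↔ k < N ∧ V k ≠ U k := by simp [hs]
  obtain ⟨M, hM, hN⟩ := exists_nonInterleaved_matching s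
    (fun k => (if V k then 1 else 0) - (if U k then 1 else 0)) (fun k hk => by
      have := ((hmem k).1 hk).2
      cases hV : V k <;> cases hU : U k <;> simp_all) (by
      rw [hs, Finset.sum_filter_of_ne (fun k _ hk => by rintro h; simp [h] at hk),
        Finset.sum_sub_distrib, Finset.sum_boole, Finset.sum_boole, h, sub_self])
  refine ⟨fun k => if k ∈ s then M k else k, fun k hk => ?_, fun k hk l hl hkl => ?_⟩
  · by_cases hks : k ∈ s
    · obtain ⟨h1, h2, h3⟩ := hM k hks
      simp only [hks, if_true, h1, h2, ((hmem _).1 h1).1, true_and]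
      have h4 := ((hmem _).1 h1).2
      have h5 := ((hmem _).1 hks).2
      cases hV : V k <;> cases hU : U k <;> cases hV' : V (M k) <;> cases hU' : U (M k) <;>
        simp_all
    · have : V k = U k := by
        by_contra h'
        exact hks ((hmem k).2 ⟨hk, h'⟩)
      simp [hks, hk, this]
  · have inv : ∀ k ∈ s, M k ∈ s ∧ M (M k) = k := fun k hk => ⟨(hM k hk).1, (hM k hk).2.1⟩
    by_cases hks : k ∈ s <;> by_cases hls : l ∈ s
    · simp only [hks, hls, if_true]
      have h1 := nonInterleaved_of_involution inv hN hks hls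
      have h2 : l = M k → M l = k := fun h => by rw [h]; exact (inv k hks).2
      have h3 : M l = k → l = M k := fun h => by rw [← h]; exact (inv l hls).2.symm
      have h4 : M k ≠ M l := fun h => hkl (by rw [← (inv k hks).2, h, (inv l hls).2])
      have h5 : M k ≠ k := fun h => by
        have := (hM k hks).2.2
        have := ((hmem k).1 hks).2
        cases hV : V k <;> cases hU : U k <;> simp_all
      have h6 : M l ≠ l := fun h => by
        have := (hM l hls).2.2
        have := ((hmem l).1 hls).2
        cases hV : V l <;> cases hU : U l <;> simp_all
      unfold NonInterleaved at *
      omega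
    · simp only [hks, hls, if_true, if_false]
      unfold NonInterleaved
      omega
    · simp only [hks, hls, if_true, if_false]
      unfold NonInterleaved
      omega
    · simp only [hks, hls, if_false]
      unfold NonInterleaved
      omega

/-! ### The path on the axis -/

/-- Whether two pairs interleave does not change if an end of each is moved past no other end. -/
lemma nonInterleaved_congr {a b a' b' p p' : ℕ}
    (h2 : b' < p ↔ b' < a) (h3 : b < p' ↔ b < a') (h4 : b' < p' ↔ b' < a')
    (h5 : b ≠ p) (h6 : b' ≠ p) (h7 : b ≠ p') (h8 : b' ≠ p') (h9 : b ≠ a) (h10 : b' ≠ a)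
    (h11 : b ≠ a') (h12 : b' ≠ a') (ha : a < a') (hp : p < p') (h : NonInterleaved a b a' b') :
    NonInterleaved p b p' b' := by
  unfold NonInterleaved at *
  omega

lemma nonInterleaved_self {p q r : ℕ} : NonInterleaved p q r q := by
  unfold NonInterleaved
  omega

lemma nonInterleaved_of_notMem {p q r s : ℕ} (hpq : p ≤ q) (hr : r ≤ p ∨ q ≤ r)
    (hs : s ≤ p ∨ q ≤ s) : NonInterleaved p q r s := by
  unfold NonInterleaved
  omega

/-- The sequence `x 0, y 0, z 0, x 1, y 1, z 1, …`. -/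
def triple (x y z : ℕ → ℕ) (m : ℕ) : ℕ :=
  if m % 3 = 0 then x (m / 3) else if m % 3 = 1 then y (m / 3) else z (m / 3)

lemma triple_zero (x y z : ℕ → ℕ) (i : ℕ) : triple x y z (3 * i) = x i := by
  simp [triple]

lemma triple_one (x y z : ℕ → ℕ) (i : ℕ) : triple x y z (3 * i + 1) = y i := by
  have h1 : (3 * i + 1) % 3 = 1 := by omega
  have h2 : (3 * i + 1) / 3 = i := by omega
  simp [triple, h1, h2]

lemma triple_two (x y z : ℕ → ℕ) (i : ℕ) : triple x y z (3 * i + 2) = z i := by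
  have h1 : (3 * i + 2) % 3 = 2 := by omega
  have h2 : (3 * i + 2) / 3 = i := by omega
  simp [triple, h1, h2]

lemma triple_three (x y z : ℕ → ℕ) (i : ℕ) : triple x y z (3 * i + 3) = x (i + 1) :=
  triple_zero x y z (i + 1)

/-- The place of the `j`-th point on the axis. -/
def pointKey (D j : ℕ) : ℕ := D * j + D

/-- The place on the axis that belongs to the `i`-th vertex of the path. The vertices of the bottom
page follow the point with number `g i`, one after the other; a vertex of the top page immediately
precedes that point. All slots increase along the path. -/
def slot (D : ℕ) (bot : ℕ → Prop) [DecidablePred bot] (g : ℕ → ℕ) (i : ℕ) : ℕ :=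
  if bot i then D * g i + D + 3 * i + 1 else D * g i + D - 2

/-- The first of the two places where the edge from the `i`-th vertex to the next meets the axis,
next to the slot of the `i`-th vertex. -/
def exitSlot (D : ℕ) (bot : ℕ → Prop) [DecidablePred bot] (g : ℕ → ℕ) (i : ℕ) : ℕ :=
  slot D bot g i + 1

/-- The second of the two places where the edge from the `i`-th vertex to the next meets the axis.
It follows the point `g i` and precedes the next slot. -/
def entrySlot (D : ℕ) (g : ℕ → ℕ) (i : ℕ) : ℕ := D * g i + D + 3 * i + 3

/-- The places on the axis through which the path runs: for every vertex `i`, the point `π i` that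
is assigned to it and the two places where the edge to the next vertex meets the axis. -/
def site (D : ℕ) (bot : ℕ → Prop) [DecidablePred bot] (g π : ℕ → ℕ) (m : ℕ) : ℕ :=
  triple (fun i => pointKey D (π i)) (exitSlot D bot g) (entrySlot D g) m

/-- Whether the arc from the `m`-th site to the next lies on the bottom page. Of the three arcs of
an edge, the outer ones lie on the pages of the ends of the edge and the middle one lies on the
bottom page. -/
def onBottom (bot : ℕ → Prop) (m : ℕ) : Prop :=
  if m % 3 = 0 then bot (m / 3) else if m % 3 = 1 then True else bot (m / 3 + 1)

lemma onBottom_zero (bot : ℕ → Prop) (i : ℕ) : onBottom bot (3 * i) ↔ bot i := by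
  simp [onBottom]

lemma onBottom_one (bot : ℕ → Prop) (i : ℕ) : onBottom bot (3 * i + 1) ↔ True := by
  have h1 : (3 * i + 1) % 3 = 1 := by omega
  simp [onBottom, h1]

lemma onBottom_two (bot : ℕ → Prop) (i : ℕ) : onBottom bot (3 * i + 2) ↔ bot (i + 1) := by
  have h1 : (3 * i + 2) % 3 = 2 := by omega
  have h2 : (3 * i + 2) / 3 = i := by omega
  simp [onBottom, h1, h2]

lemma mul_add_ne {D j g o : ℕ} (h0 : 0 < o) (h1 : o < D) : D * j ≠ D * g + o := by
  rcases Nat.lt_or_ge g j with h | h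
  · have := Nat.mul_le_mul_left D (Nat.succ_le_of_lt h)
    rw [Nat.mul_succ] at this; omega
  · have := Nat.mul_le_mul_left D h
    omega

/-- If the pairs that consist of the slot of a vertex and of the point assigned to it do not
interleave on either page, then neither do the arcs of the path: no point of its page separates the
slot of a vertex from the two places next to it where the path meets the axis, so each of the arcs
from there to the point of the vertex runs along the arc from the slot. Here `g i` is the number of
the last point of the top page that the path has passed at the `i`-th vertex. -/
theorem site_spec {n D : ℕ} {bot : ℕ → Prop} [DecidablePred bot] {g π : ℕ → ℕ} {pbot : ℕ → Prop}
    (hD : 3 * n + 8 ≤ D)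
    (hbot : ∀ i, bot (i + 1) → g (i + 1) = g i)
    (htop : ∀ i, ¬ bot (i + 1) → g i < g (i + 1) ∧ ∀ j, g i < j → j < g (i + 1) → pbot j)
    (hg : ∀ i, ¬ pbot (g i))
    (hπ : ∀ i < n, pbot (π i) ↔ bot i)
    (hinj : ∀ i < n, ∀ j < n, π i = π j → i = j)
    (hNC : ∀ i < n, ∀ j < n, i ≠ j → (bot i ↔ bot j) →
      NonInterleaved (slot D bot g i) (pointKey D (π i)) (slot D bot g j) (pointKey D (π j))) :
    (∀ m < 3 * n, ∀ m' < 3 * n, site D bot g π m = site D bot g π m' → m = m') ∧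
    ∀ m m', m < m' → m' + 3 < 3 * n → (onBottom bot m ↔ onBottom bot m') →
      NonInterleaved (site D bot g π m) (site D bot g π (m + 1))
        (site D bot g π m') (site D bot g π (m' + 1)) := by
  have hmul : ∀ {x y : ℕ}, x < y → D * x + D ≤ D * y := fun {x y} h => by
    have := Nat.mul_le_mul_left D (Nat.succ_le_of_lt h)
    rwa [Nat.mul_succ] at this
  -- keys of points avoid all slots
  have hslot_ne : ∀ i < n, ∀ j, pointKey D j ≠ slot D bot g i := by
    intro i hi j
    unfold slot pointKey
    split_ifs
    · have := @mul_add_ne D j (g i) (3 * i + 1) (by omega) (by omega); omega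
    · have := @mul_add_ne D j (g i) (D - 2) (by omega) (by omega)
      intro h
      exact @mul_add_ne D (j + 1) (g i) (D - 2) (by omega) (by omega) (by rw [Nat.mul_succ]; omega)
  have hexit_ne : ∀ i < n, ∀ j, pointKey D j ≠ exitSlot D bot g i := by
    intro i hi j
    unfold exitSlot slot pointKey
    split_ifs
    · have := @mul_add_ne D j (g i) (3 * i + 2) (by omega) (by omega); omega
    · intro h
      exact @mul_add_ne D (j + 1) (g i) (D - 1) (by omega) (by omega) (by rw [Nat.mul_succ]; omega)
  have hentry_ne : ∀ i < n, ∀ j, pointKey D j ≠ entrySlot D g i := by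
    intro i hi j
    unfold entrySlot pointKey
    have := @mul_add_ne D j (g i) (3 * i + 3) (by omega) (by omega); omega
  have h12 : ∀ i, slot D bot g i < exitSlot D bot g i := fun i => Nat.lt_succ_self _
  have h23 : ∀ i, exitSlot D bot g i < entrySlot D g i := fun i => by
    unfold exitSlot entrySlot slot; split_ifs <;> omega
  have h34 : ∀ i < n, entrySlot D g i < slot D bot g (i + 1) := fun i hi => by
    unfold entrySlot slot
    split_ifs with h
    · rw [hbot i h]; omega
    · have := hmul (htop i h).1; omega
  have hmono : ∀ j, j ≤ n → ∀ i < j, entrySlot D g i < slot D bot g j := by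
    intro j
    induction j with
    | zero => intro _ i hi; omega
    | succ j ih =>
      intro hj i hi
      rcases Nat.lt_succ_iff_lt_or_eq.1 hi with h | rfl
      · exact (ih (by omega) i h).trans (((h12 j).trans (h23 j)).trans (h34 j (by omega)))
      · exact h34 i (by omega)
  -- no point of the bottom page has its key strictly between the exit and the entry slot
  have hbetween : ∀ i < n, ∀ j, pbot j →
      pointKey D j < exitSlot D bot g i ∨ entrySlot D g i < pointKey D j := by
    intro i hi j hj
    unfold exitSlot entrySlot slot pointKey
    rcases lt_trichotomy j (g i) with h | h | h
    · have := hmul h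
      left; split_ifs <;> omega
    · subst h; exact absurd hj (hg i)
    · have := hmul h; right; omega
  have hexit_lt : ∀ i < n, ∀ j,
      pointKey D j < exitSlot D bot g i ↔ pointKey D j < slot D bot g i := by
    intro i hi j
    have := hslot_ne i hi j
    unfold exitSlot; omega
  have hentry_lt : ∀ i, i + 1 < n → ∀ j, (pbot j ↔ bot (i + 1)) →
      (pointKey D j < entrySlot D g i ↔ pointKey D j < slot D bot g (i + 1)) := by
    intro i hi j hj
    refine ⟨fun h => h.trans (h34 i (by omega)), fun h => ?_⟩
    by_contra h'
    have h1 := hentry_ne i (by omega) j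
    by_cases hb : bot (i + 1)
    · unfold slot entrySlot pointKey at *
      rw [if_pos hb, hbot i hb] at h; omega
    · obtain ⟨h2, h3⟩ := htop i hb
      have h4 : g i < j := by
        by_contra h4
        have := Nat.mul_le_mul_left D (not_lt.1 h4)
        unfold entrySlot pointKey at *; omega
      have h5 : j < g (i + 1) := by
        by_contra h5
        have := Nat.mul_le_mul_left D (not_lt.1 h5)
        unfold slot pointKey at *
        rw [if_neg hb] at h; omega
      exact hb (hj.1 (h3 j h4 h5))
  -- a leg joins the point of a vertex to one of the two slots next to the slot of the vertex
  have hleg : ∀ i < n, ∀ j < n, i < j → (bot i ↔ bot j) → ∀ p p',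
      (p = exitSlot D bot g i ∨ ∃ k, k + 1 = i ∧ p = entrySlot D g k) →
      (p' = exitSlot D bot g j ∨ ∃ k, k + 1 = j ∧ p' = entrySlot D g k) →
      NonInterleaved p (pointKey D (π i)) p' (pointKey D (π j)) := by
    have aux : ∀ i < n, ∀ p, (p = exitSlot D bot g i ∨ ∃ k, k + 1 = i ∧ p = entrySlot D g k) →
        ∀ j < n, (bot i ↔ bot j) →
          (pointKey D (π j) < p ↔ pointKey D (π j) < slot D bot g i) ∧ pointKey D (π j) ≠ p := by
      rintro i hi p (rfl | ⟨k, rfl, rfl⟩) j hj hij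
      · exact ⟨hexit_lt i hi _, hexit_ne i hi _⟩
      · exact ⟨hentry_lt k hi _ ((hπ j hj).trans hij.symm), hentry_ne k (by omega) _⟩
    intro i hi j hj hij hb p p' hp hp'
    obtain ⟨a1, a2⟩ := aux i hi p hp i hi Iff.rfl
    obtain ⟨a3, a4⟩ := aux i hi p hp j hj hb
    obtain ⟨a5, a6⟩ := aux j hj p' hp' i hi hb.symm
    obtain ⟨a7, a8⟩ := aux j hj p' hp' j hj Iff.rfl
    have hij1 := hmono j hj.le i hij
    have hij2 := h12 i
    have hij3 := h23 i
    refine nonInterleaved_congr a3 a5 a7 a2 a4 a6 a8 (hslot_ne i hi _) (hslot_ne i hi _)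
      (hslot_ne j hj _) (hslot_ne j hj _) (by omega) ?_ (hNC i hi j hj hij.ne hb)
    have hp1 : p ≤ exitSlot D bot g i := by
      rcases hp with rfl | ⟨k, rfl, rfl⟩
      · exact le_rfl
      · have := h34 k (by omega); omega
    have hp2 : entrySlot D g i ≤ p' := by
      rcases hp' with rfl | ⟨k, rfl, rfl⟩
      · have := h12 j; omega
      · rcases Nat.lt_succ_iff_lt_or_eq.1 hij with h | rfl
        · have := hmono k (by omega) i h
          have := h12 k; have := h23 k; omega
        · exact le_rfl
    omega
  have hlegs : ∀ i < n, ∀ j < n, i ≤ j → (bot i ↔ bot j) → ∀ p p',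
      (p = exitSlot D bot g i ∨ ∃ k, k + 1 = i ∧ p = entrySlot D g k) →
      (p' = exitSlot D bot g j ∨ ∃ k, k + 1 = j ∧ p' = entrySlot D g k) →
      NonInterleaved p (pointKey D (π i)) p' (pointKey D (π j)) := by
    intro i hi j hj hij hb p p' hp hp'
    rcases hij.lt_or_eq with h | rfl
    · exact hleg i hi j hj h hb p p' hp hp'
    · exact nonInterleaved_self
  have hsplit : ∀ m : ℕ, ∃ i, m = 3 * i ∨ m = 3 * i + 1 ∨ m = 3 * i + 2 := fun m =>
    ⟨m / 3, by omega⟩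
  have hkey_inj : ∀ i < n, ∀ j < n,
      pointKey D (π i) = pointKey D (π j) → i = j := fun i hi j hj h => by
    apply hinj i hi j hj
    unfold pointKey at h
    exact Nat.eq_of_mul_eq_mul_left (by omega : 0 < D) (by omega)
  refine ⟨fun m hm m' hm' h => ?_, fun m m' hmm hm' hpg => ?_⟩
  · obtain ⟨i, hi⟩ := hsplit m
    obtain ⟨j, hj⟩ := hsplit m'
    have hin : i < n := by omega
    have hjn : j < n := by omega
    have m1 := hmono i hin.le j
    have m2 := hmono j hjn.le i
    have := h12 i
    have := h12 j
    have := h23 i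
    have := h23 j
    unfold site at h
    rcases hi with rfl | rfl | rfl <;> rcases hj with rfl | rfl | rfl <;>
      simp only [triple_zero, triple_one, triple_two] at h
    · rw [hkey_inj i hin j hjn h]
    · exact absurd h (hexit_ne j hjn _)
    · exact absurd h (hentry_ne j hjn _)
    · exact absurd h.symm (hexit_ne i hin _)
    · omega
    · rcases eq_or_ne i j with rfl | hne <;> omega
    · exact absurd h.symm (hentry_ne i hin _)
    · rcases eq_or_ne i j with rfl | hne <;> omega
    · omega
  · obtain ⟨i, hi⟩ := hsplit m
    obtain ⟨j, hj⟩ := hsplit m'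
    have hin : i + 1 < n := by omega
    have hjn : j + 1 < n := by omega
    have m2 := hmono j (by omega) i
    have := h12 i
    have := h12 j
    have := h23 i
    have := h23 j
    have keyb : ∀ k < n, ∀ l < n, bot k → pointKey D (π k) ≤ exitSlot D bot g l ∨
        entrySlot D g l ≤ pointKey D (π k) := fun k hk l hl hb => by
      have := hbetween l hl (π k) ((hπ k hk).2 hb)
      omega
    unfold site
    rcases hi with rfl | rfl | rfl <;> rcases hj with rfl | rfl | rfl <;>
      simp only [triple_zero, triple_one, triple_two, triple_three, onBottom_zero, onBottom_one,
        onBottom_two, add_assoc, Nat.reduceAdd, iff_true, true_iff] at hpg ⊢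
    · rw [nonInterleaved_swap_left, nonInterleaved_swap_right]
      exact hlegs i (by omega) j (by omega) (by omega) hpg _ _ (Or.inl rfl) (Or.inl rfl)
    · rw [nonInterleaved_comm]
      refine nonInterleaved_of_notMem (by omega) (keyb i (by omega) j (by omega) hpg) ?_
      rcases Nat.lt_or_ge i j with h | h
      · have := m2 h; omega
      · have : i = j := by omega
        subst this; omega
    · rw [nonInterleaved_swap_left]
      exact hlegs i (by omega) (j + 1) hjn (by omega) hpg _ _ (Or.inl rfl) (Or.inr ⟨j, rfl, rfl⟩)
    · refine nonInterleaved_of_notMem (by omega) (keyb j (by omega) i (by omega) hpg) ?_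
      have := m2 (by omega); omega
    · refine nonInterleaved_of_notMem (by omega) ?_ ?_ <;>
      · have := m2 (by omega); omega
    · refine nonInterleaved_of_notMem (by omega) ?_ (keyb (j + 1) (by omega) i (by omega) hpg)
      rcases Nat.lt_or_ge i j with h | h
      · have := m2 h; omega
      · have : i = j := by omega
        subst this; omega
    · rw [nonInterleaved_swap_right]
      exact hlegs (i + 1) hin j (by omega) (by omega) hpg _ _ (Or.inr ⟨i, rfl, rfl⟩) (Or.inl rfl)
    · rw [nonInterleaved_comm]
      refine nonInterleaved_of_notMem (by omega) ?_ (keyb (i + 1) (by omega) j (by omega) hpg)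
      have := m2 (by omega); omega
    · exact hlegs (i + 1) hin (j + 1) hjn (by omega) hpg _ _ (Or.inr ⟨i, rfl, rfl⟩)
        (Or.inr ⟨j, rfl, rfl⟩)

/-! ### Assignment of the vertices to the points -/

lemma card_filter_nth_count (p : ℕ → Prop) [DecidablePred p] (hp : (Set.ofPred p).Infinite)
    (Q : ℕ → Prop) [DecidablePred Q] (n : ℕ) :
    ((Finset.range (Nat.count p n)).filter fun k => Q (Nat.nth p k)).card =
      ((Finset.range n).filter fun i => p i ∧ Q i).card := by
  refine Finset.card_bij (fun k _ => Nat.nth p k) (fun k hk => ?_) (fun k _ l _ h => ?_)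
    (fun i hi => ?_)
  · simp only [Finset.mem_filter, Finset.mem_range] at hk ⊢
    exact ⟨Nat.nth_lt_of_lt_count hk.1, Nat.nth_mem_of_infinite hp k, hk.2⟩
  · exact Nat.nth_injective hp h
  · simp only [Finset.mem_filter, Finset.mem_range] at hi
    refine ⟨Nat.count p i, ?_, Nat.nth_count hi.2.1⟩
    simp only [Finset.mem_filter, Finset.mem_range, Nat.nth_count hi.2.1]
    exact ⟨Nat.count_strict_mono hi.2.1 hi.1, hi.2.2⟩

/-- The combinatorial core. Vertices and points of color `2` belong to the bottom page, the others
to the top page. The axis is arranged so that the `k`-th vertex and the `k`-th point of the top page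
meet; there the lockstep matching applies to the colors `0` and `1`, and any noncrossing matching
serves for color `2`. The words continue with colors of the top page beyond `n`, so that all ranks
are defined; `D * j + D` is the place of the `j`-th point. -/
theorem exists_nonInterleaved_sites {n : ℕ} {c σ : ℕ → Fin 3} (h0 : c 0 ≠ 2)
    (hc : ∀ i, n ≤ i → c i ≠ 2) (hσ : ∀ j, n ≤ j → σ j ≠ 2)
    (hcount : ∀ x, ((Finset.range n).filter fun i => c i = x).card =
      ((Finset.range n).filter fun j => σ j = x).card) :
    ∃ (D : ℕ) (π t : ℕ → ℕ) (pg : ℕ → Prop), 0 < D ∧ (∀ i < n, π i < n ∧ σ (π i) = c i) ∧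
      (∀ i < n, ∀ j < n, π i = π j → i = j) ∧ (0 < n → σ 0 = c 0 → π 0 = 0) ∧
      (∀ i, t (3 * i) = D * π i + D) ∧
      (∀ m < 3 * n, ∀ m' < 3 * n, t m = t m' → m = m') ∧
      ∀ m m', m < m' → m' + 3 < 3 * n → (pg m ↔ pg m') →
        NonInterleaved (t m) (t (m + 1)) (t m') (t (m' + 1)) := by
  classical
  set p : ℕ → Prop := fun i => c i ≠ 2 with hp
  set u : ℕ → Prop := fun j => σ j ≠ 2 with hu
  have hpinf : (Set.ofPred p).Infinite :=
    (Set.Ici_infinite n).mono fun i hi => hc i hi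
  have huinf : (Set.ofPred u).Infinite :=
    (Set.Ici_infinite n).mono fun i hi => hσ i hi
  have hcnt : Nat.count p n = Nat.count u n := by
    have h1 := hcount 2
    have h2 := Finset.card_filter_add_card_filter_not (s := Finset.range n) (fun i => c i = 2)
    have h3 := Finset.card_filter_add_card_filter_not (s := Finset.range n) (fun j => σ j = 2)
    rw [Nat.count_eq_card_filter_range, Nat.count_eq_card_filter_range]
    simp only [hp, hu, ne_eq]
    omega
  -- matching of the ranks of the vertices and points of colors 0 and 1
  obtain ⟨ρ, hρ, hρN⟩ := exists_lockstep_matching (Nat.count p n)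
    (fun k => decide (c (Nat.nth p k) = 1)) (fun k => decide (σ (Nat.nth u k) = 1)) (by
      simp only [decide_eq_true_eq]
      rw [card_filter_nth_count p hpinf (fun i => c i = 1)]
      conv_rhs => rw [hcnt]
      rw [card_filter_nth_count u huinf (fun i => σ i = 1)]
      have e1 : ∀ i, (p i ∧ c i = 1) ↔ c i = 1 := fun i => by
        simp only [hp]; constructor
        · exact fun h => h.2
        · intro h; rw [h]; decide
      have e2 : ∀ i, (u i ∧ σ i = 1) ↔ σ i = 1 := fun i => by
        simp only [hu]; constructor
        · exact fun h => h.2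
        · intro h; rw [h]; decide
      simp only [e1, e2]
      exact hcount 1)
  set D := 3 * n + 8 with hD
  set bot : ℕ → Prop := fun i => c i = 2 with hbotdef
  set g : ℕ → ℕ := fun i => Nat.nth u (Nat.count p (i + 1) - 1) with hgdef
  have hcpos : ∀ i, 0 < Nat.count p (i + 1) := fun i => by
    have h1 : Nat.count p 1 ≤ Nat.count p (i + 1) := Nat.count_monotone p (by omega)
    have h2 : Nat.count p 1 = 1 := by rw [Nat.count_succ]; simp [hp, h0]
    omega
  have hug : ∀ i, ¬ (fun j => σ j = 2) (g i) := fun i => Nat.nth_mem_of_infinite huinf _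
  have hgbot : ∀ i, bot (i + 1) → g (i + 1) = g i := fun i hi => by
    have hi' : c (i + 1) = 2 := hi
    simp only [hgdef]
    rw [Nat.count_succ p (i + 1), if_neg (by simp [hp, hi']), add_zero]
  have hgtop : ∀ i, ¬ bot (i + 1) → g i < g (i + 1) ∧
      ∀ j, g i < j → j < g (i + 1) → (fun j => σ j = 2) j := fun i hi => by
    have hi' : ¬ c (i + 1) = 2 := hi
    have h1 : Nat.count p (i + 1 + 1) - 1 = (Nat.count p (i + 1) - 1) + 1 := by
      rw [Nat.count_succ p (i + 1), if_pos (by simp [hp, hi'])]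
      have := hcpos i; omega
    simp only [hgdef, h1]
    refine ⟨Nat.nth_strictMono huinf (Nat.lt_succ_self _), fun j hj hj' => ?_⟩
    by_contra h
    have h2 := Nat.count_strict_mono (p := u) h hj'
    rw [Nat.count_nth_of_infinite huinf] at h2
    have h3 := Nat.count_monotone u hj
    rw [Nat.count_succ, if_pos (Nat.nth_mem_of_infinite huinf _),
      Nat.count_nth_of_infinite huinf] at h3
    omega
  -- matching of the vertices and points of color 2
  have hslotinj : Set.InjOn (slot D bot g)
      (((Finset.range n).filter fun i => c i = 2) : Finset ℕ) := by
    intro i hi j hj hij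
    simp only [Finset.coe_filter, Finset.mem_range, Set.mem_ofPred_eq] at hi hj
    unfold slot at hij
    rw [if_pos hi.2, if_pos hj.2] at hij
    rcases lt_trichotomy (g i) (g j) with h | h | h
    · have := Nat.mul_le_mul_left D (Nat.succ_le_of_lt h)
      rw [Nat.mul_succ] at this; omega
    · rw [h] at hij; omega
    · have := Nat.mul_le_mul_left D (Nat.succ_le_of_lt h)
      rw [Nat.mul_succ] at this; omega
  have hkeyinj : Function.Injective (pointKey D) := fun i j h => by
    unfold pointKey at h
    exact Nat.eq_of_mul_eq_mul_left (by omega : 0 < D) (by omega)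
  obtain ⟨M, hM, hMinj, hMN⟩ := exists_nonInterleaved_bijection
    (((Finset.range n).filter fun i => c i = 2).image (slot D bot g))
    (((Finset.range n).filter fun j => σ j = 2).image (pointKey D))
    (by
      rw [Finset.disjoint_left]
      intro x hx hx'
      obtain ⟨i, hi, rfl⟩ := Finset.mem_image.1 hx
      obtain ⟨j, hj, hji⟩ := Finset.mem_image.1 hx'
      rw [Finset.mem_filter, Finset.mem_range] at hi hj
      unfold slot pointKey at hji
      rw [if_pos hi.2] at hji
      exact @mul_add_ne D j (g i) (3 * i + 1) (by omega) (by omega) (by omega))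
    (by
      rw [Finset.card_image_of_injOn hslotinj, Finset.card_image_of_injective _ hkeyinj]
      exact hcount 2)
  have hMex : ∀ i, ∃ j, i < n → c i = 2 → j < n ∧ σ j = 2 ∧ pointKey D j = M (slot D bot g i) := by
    intro i
    by_cases hi : i < n ∧ c i = 2
    · obtain ⟨j, hj, hj'⟩ := Finset.mem_image.1 (hM _ (Finset.mem_image_of_mem (slot D bot g)
        (Finset.mem_filter.2 ⟨Finset.mem_range.2 hi.1, hi.2⟩)))
      rw [Finset.mem_filter, Finset.mem_range] at hj
      exact ⟨j, fun _ _ => ⟨hj.1, hj.2, hj'⟩⟩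
    · exact ⟨0, fun h h' => absurd ⟨h, h'⟩ hi⟩
  choose τ hτ using hMex
  set π : ℕ → ℕ := fun i => if c i = 2 then τ i else Nat.nth u (ρ (Nat.count p i)) with hπdef
  have hπbot : ∀ i, c i = 2 → π i = τ i := fun i hi => if_pos hi
  have hπtop : ∀ i, c i ≠ 2 → π i = Nat.nth u (ρ (Nat.count p i)) := fun i hi => if_neg hi
  have hrank : ∀ i < n, c i ≠ 2 → Nat.count p i < Nat.count p n := fun i hi hi' =>
    Nat.count_strict_mono (p := p) hi' hi
  have hπcol : ∀ i < n, π i < n ∧ σ (π i) = c i := by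
    intro i hi
    by_cases hi2 : c i = 2
    · rw [hπbot i hi2, hi2]
      exact ⟨(hτ i hi hi2).1, (hτ i hi hi2).2.1⟩
    · rw [hπtop i hi2]
      obtain ⟨h1, -, h3, -⟩ := hρ _ (hrank i hi hi2)
      rw [Nat.nth_count (p := p) hi2, decide_eq_decide] at h3
      have h4 : σ (Nat.nth u (ρ (Nat.count p i))) ≠ 2 := Nat.nth_mem_of_infinite huinf _
      refine ⟨Nat.nth_lt_of_lt_count (hcnt ▸ h1), ?_⟩
      generalize σ (Nat.nth u (ρ (Nat.count p i))) = x at *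
      generalize c i = y at *
      revert x y; decide
  have hπinj : ∀ i < n, ∀ j < n, π i = π j → i = j := by
    intro i hi j hj hij
    have hcc : c i = c j := by rw [← (hπcol i hi).2, hij, (hπcol j hj).2]
    by_cases hi2 : c i = 2
    · have hj2 : c j = 2 := hcc ▸ hi2
      rw [hπbot i hi2, hπbot j hj2] at hij
      have h1 := (hτ i hi hi2).2.2
      rw [hij, (hτ j hj hj2).2.2] at h1
      have mi : i ∈ (Finset.range n).filter fun i => c i = 2 :=
        Finset.mem_filter.2 ⟨Finset.mem_range.2 hi, hi2⟩
      have mj : j ∈ (Finset.range n).filter fun i => c i = 2 :=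
        Finset.mem_filter.2 ⟨Finset.mem_range.2 hj, hj2⟩
      exact (hslotinj mj mi (hMinj (Finset.mem_image_of_mem _ mj)
        (Finset.mem_image_of_mem _ mi) h1)).symm
    · have hj2 : c j ≠ 2 := hcc ▸ hi2
      rw [hπtop i hi2, hπtop j hj2] at hij
      have h1 := Nat.nth_injective huinf hij
      have h2 := (hρ _ (hrank i hi hi2)).2.1
      rw [h1, (hρ _ (hrank j hj hj2)).2.1] at h2
      exact (Nat.count_injective (p := p) hj2 hi2 h2).symm
  have hNC : ∀ i < n, ∀ j < n, i ≠ j → (bot i ↔ bot j) →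
      NonInterleaved (slot D bot g i) (pointKey D (π i)) (slot D bot g j) (pointKey D (π j)) := by
    intro i hi j hj hij hb
    by_cases hi2 : c i = 2
    · have hj2 : c j = 2 := hb.1 hi2
      rw [hπbot i hi2, hπbot j hj2, (hτ i hi hi2).2.2, (hτ j hj hj2).2.2]
      exact hMN _ (Finset.mem_image_of_mem _ (Finset.mem_filter.2 ⟨Finset.mem_range.2 hi, hi2⟩))
        _ (Finset.mem_image_of_mem _ (Finset.mem_filter.2 ⟨Finset.mem_range.2 hj, hj2⟩))
    · have hj2 : c j ≠ 2 := fun h => hi2 (hb.2 h)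
      have h1 := hρN _ (hrank i hi hi2) _ (hrank j hj hj2)
        fun h => hij (Nat.count_injective (p := p) hi2 hj2 h)
      -- even numbers go to slots and odd ones to points
      set e : ℕ → ℕ := fun x => D * Nat.nth u (x / 2) + D - 2 + 2 * (x % 2) with he
      have hemono : StrictMono e := by
        refine strictMono_nat_of_lt_succ fun x => ?_
        rcases Nat.even_or_odd' x with ⟨y, rfl | rfl⟩
        · have a1 : 2 * y / 2 = y := by omega
          have a2 : (2 * y + 1) / 2 = y := by omega
          have a3 : 2 * y % 2 = 0 := by omega
          have a4 : (2 * y + 1) % 2 = 1 := by omega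
          simp only [he, a1, a2, a3, a4]; omega
        · have a1 : (2 * y + 1) / 2 = y := by omega
          have a2 : (2 * y + 1 + 1) / 2 = y + 1 := by omega
          have a3 : (2 * y + 1) % 2 = 1 := by omega
          have a4 : (2 * y + 1 + 1) % 2 = 0 := by omega
          have a5 := Nat.mul_le_mul_left D
            (Nat.succ_le_of_lt (Nat.nth_strictMono huinf (Nat.lt_succ_self y)))
          rw [Nat.mul_succ, Nat.succ_eq_add_one] at a5
          simp only [he, a1, a2, a3, a4]; omega
      have heven : ∀ i, c i ≠ 2 → e (2 * Nat.count p i) = slot D bot g i := fun i hi => by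
        have a1 : 2 * Nat.count p i / 2 = Nat.count p i := by omega
        have a2 : 2 * Nat.count p i % 2 = 0 := by omega
        have a3 : Nat.count p (i + 1) - 1 = Nat.count p i := by
          rw [Nat.count_succ, if_pos (show p i from hi)]; omega
        unfold slot
        rw [if_neg (show ¬ bot i from hi)]
        simp only [he, hgdef, a1, a2, a3]; omega
      have hodd : ∀ k, e (2 * k + 1) = pointKey D (Nat.nth u k) := fun k => by
        have a1 : (2 * k + 1) / 2 = k := by omega
        have a2 : (2 * k + 1) % 2 = 1 := by omega
        simp only [he, pointKey, a1, a2]; omega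
      have h2 := h1.map_strictMono hemono
      rwa [heven i hi2, heven j hj2, hodd, hodd, ← hπtop i hi2, ← hπtop j hj2] at h2
  obtain ⟨H1, H2⟩ := site_spec (n := n) (D := D) (bot := bot) (g := g) (π := π)
    (pbot := fun j => σ j = 2) le_rfl hgbot hgtop hug
    (fun i hi => by simp only [hbotdef, (hπcol i hi).2]) hπinj hNC
  refine ⟨D, π, site D bot g π, onBottom bot, by omega, hπcol, hπinj, fun hn h => ?_,
    fun i => ?_, H1, H2⟩
  · have h1 : Nat.nth u 0 = 0 := Nat.nth_zero_of_zero (show u 0 by simp only [hu, h]; exact h0)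
    have h2 := hrank 0 hn h0
    rw [Nat.count_zero] at h2
    have h3 := (hρ 0 h2).2.2.2 (by
      rw [h1, Nat.nth_zero_of_zero (show p 0 from h0), h])
    rw [hπtop 0 h0, Nat.count_zero, h3, h1]
  rw [site, triple_zero, pointKey]

/-! ### Real positions of the places on the axis -/

lemma exists_strictMono_extension {n : ℕ} {x : Fin n → ℝ} (hx : StrictMono x) (k : ℕ) :
    ∃ X : ℕ → ℝ, StrictMono X ∧ ∀ j : Fin n, X (j + k) = x j := by
  obtain ⟨C, h0, hC⟩ : ∃ C, 0 ≤ C ∧ ∀ j, |x j| < C := by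
    obtain ⟨C, hC⟩ := (Set.finite_range fun j => |x j|).bddAbove
    exact ⟨|C| + 1, by positivity, fun j => ((hC ⟨j, rfl⟩).trans (le_abs_self C)).trans_lt
      (lt_add_one _)⟩
  refine ⟨fun m => if m < k then m - k - C else
    if h : m - k < n then x ⟨m - k, h⟩ else m + C, ?_, fun j => ?_⟩
  · refine strictMono_nat_of_lt_succ fun m => ?_
    simp only [Nat.cast_add, Nat.cast_one]
    split_ifs with h1 h2 h3 h4 h5 h6 h7
    · linarith
    · have := (abs_lt.1 (hC ⟨_, h3⟩)).1
      have : (m : ℝ) < k := by exact_mod_cast h1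
      linarith
    · have : (m : ℝ) < k := by exact_mod_cast h1
      linarith
    all_goals first | omega | skip
    · apply hx
      rw [Fin.lt_def]
      show m - k < m + 1 - k
      omega
    · have := (abs_lt.1 (hC ⟨_, ‹m - k < n›⟩)).2
      have : (0 : ℝ) ≤ m := Nat.cast_nonneg m
      linarith
    · linarith
  · have h1 : ¬ ((j : ℕ) + k < k) := by omega
    simp [h1]

lemma exists_strictMono_interpolation {X : ℕ → ℝ} (hX : StrictMono X) {D : ℕ} (hD : 0 < D) :
    ∃ Y : ℕ → ℝ, StrictMono Y ∧ ∀ j, Y (D * j) = X j := by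
  have hD' : (0 : ℝ) < D := by exact_mod_cast hD
  refine ⟨fun m => X (m / D) + (m % D : ℕ) / D * (X (m / D + 1) - X (m / D)), ?_, fun j => ?_⟩
  · refine strictMono_nat_of_lt_succ fun m => ?_
    have hd := Nat.div_add_mod m D
    have hlt := Nat.mod_lt m hD
    set q := m / D
    set r := m % D
    have hpos : 0 < X (q + 1) - X q := sub_pos.2 (hX (Nat.lt_succ_self q))
    rcases Nat.lt_or_ge (r + 1) D with h | h
    · have h1 : (m + 1) / D = q := by
        rw [← hd, add_assoc, Nat.mul_add_div hD, Nat.div_eq_of_lt h, add_zero]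
      have h2 : (m + 1) % D = r + 1 := by
        rw [← hd, add_assoc, Nat.mul_add_mod, Nat.mod_eq_of_lt h]
      simp only [h1, h2]
      gcongr
      omega
    · have h3 : m + 1 = D * (q + 1) := by rw [Nat.mul_succ]; omega
      have h1 : (m + 1) / D = q + 1 := by rw [h3, Nat.mul_div_cancel_left _ hD]
      have h2 : (m + 1) % D = 0 := by rw [h3, Nat.mul_mod_right]
      simp only [h1, h2, Nat.cast_zero, zero_div, zero_mul, add_zero]
      have h4 : (r : ℝ) / D < 1 := by
        rw [div_lt_one hD']; exact_mod_cast hlt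
      nlinarith
  · simp [Nat.mul_div_cancel_left _ hD]

/-! ### Separated polylines -/

/-- Some line strictly separates `a`, `b` from `c`, `d`. -/
def StrictlySeparated (a b c d : Plane) : Prop :=
  ∃ (f : Plane →L[ℝ] ℝ) (r : ℝ), f a < r ∧ f b < r ∧ r < f c ∧ r < f d

/-- Some line through `c` strictly separates `a` from `b`. -/
def SeparatedAt (a c b : Plane) : Prop :=
  ∃ f : Plane →L[ℝ] ℝ, f a < f c ∧ f c < f b

lemma lt_of_mem_segment {a b x : Plane} {f : Plane →L[ℝ] ℝ} {r : ℝ} (ha : f a < r) (hb : f b < r)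
    (hx : x ∈ segment ℝ a b) : f x < r :=
  (convex_halfSpace_lt f.toLinearMap.isLinear r).segment_subset ha hb hx

lemma gt_of_mem_segment {a b x : Plane} {f : Plane →L[ℝ] ℝ} {r : ℝ} (ha : r < f a) (hb : r < f b)
    (hx : x ∈ segment ℝ a b) : r < f x :=
  (convex_halfSpace_gt f.toLinearMap.isLinear r).segment_subset ha hb hx

lemma StrictlySeparated.notMem {a b c d x : Plane} (h : StrictlySeparated a b c d)
    (hx : x ∈ segment ℝ a b) : x ∉ segment ℝ c d := by
  obtain ⟨f, r, h1, h2, h3, h4⟩ := h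
  exact fun hx' => lt_asymm (lt_of_mem_segment h1 h2 hx) (gt_of_mem_segment h3 h4 hx')

lemma SeparatedAt.eq {a c b x : Plane} (h : SeparatedAt a c b)
    (hx : x ∈ segment ℝ a c) (hx' : x ∈ segment ℝ c b) : x = c := by
  obtain ⟨f, h1, h2⟩ := h
  obtain ⟨s, t, hs, ht, hst, rfl⟩ := hx
  obtain ⟨s', t', hs', ht', hst', he⟩ := hx'
  have h3 := congrArg f he
  simp only [map_add, map_smul, smul_eq_mul] at h3
  obtain rfl : t = 1 - s := by linarith
  obtain rfl : s' = 1 - t' := by linarith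
  have : s = 0 := by
    by_contra hne
    have : 0 < s := lt_of_le_of_ne hs (Ne.symm hne)
    nlinarith [mul_pos this (sub_pos.2 h1), mul_nonneg ht' (sub_pos.2 h2).le]
  subst this
  simp

/-- Every two segments among the first `M` segments of the polyline with corners `w` are
separated: strictly, or at their common corner if they are consecutive. -/
def SeparatedPolyline (w : ℕ → Plane) (M : ℕ) : Prop :=
  (∀ m, m + 1 < M → SeparatedAt (w m) (w (m + 1)) (w (m + 2))) ∧
  ∀ m m', m + 1 < m' → m' < M → StrictlySeparated (w m) (w (m + 1)) (w m') (w (m' + 1))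

lemma SeparatedPolyline.inter {w : ℕ → Plane} {M : ℕ} (h : SeparatedPolyline w M) {m m' : ℕ}
    (hm : m < m') (hm' : m' < M) {x : Plane} (hx : x ∈ segment ℝ (w m) (w (m + 1)))
    (hx' : x ∈ segment ℝ (w m') (w (m' + 1))) : m' = m + 1 ∧ x = w m' := by
  rcases Nat.lt_or_ge (m + 1) m' with h1 | h1
  · exact absurd hx' ((h.2 m m' h1 hm').notMem hx)
  · obtain rfl : m' = m + 1 := by omega
    exact ⟨rfl, (h.1 m hm').eq hx hx'⟩

lemma SeparatedPolyline.ne {w : ℕ → Plane} {M : ℕ} (h : SeparatedPolyline w M) (hM : 2 ≤ M) {m : ℕ}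
    (hm : m < M) : w m ≠ w (m + 1) := by
  intro he
  rcases Nat.lt_or_ge (m + 1) M with h1 | h1
  · obtain ⟨f, h2, -⟩ := h.1 m h1
    rw [he] at h2; exact lt_irrefl _ h2
  · obtain ⟨k, rfl⟩ : ∃ k, m = k + 1 := ⟨m - 1, by omega⟩
    obtain ⟨f, -, h2⟩ := h.1 k hm
    rw [he] at h2; exact lt_irrefl _ h2

lemma SeparatedPolyline.of_comp {w : ℕ → Plane} {M : ℕ} (e : Plane →L[ℝ] Plane)
    (h : SeparatedPolyline (fun m => e (w m)) M) : SeparatedPolyline w M := by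
  refine ⟨fun m hm => ?_, fun m m' hm hm' => ?_⟩
  · obtain ⟨f, h1⟩ := h.1 m hm
    exact ⟨f.comp e, h1⟩
  · obtain ⟨f, r, h1⟩ := h.2 m m' hm hm'
    exact ⟨f.comp e, r, h1⟩

/-- Being separated is stable under small perturbations. -/
lemma SeparatedPolyline.eventually {w : ℝ → ℕ → Plane} {M : ℕ} {t₀ : ℝ}
    (hw : ∀ m, ContinuousAt (fun t => w t m) t₀) (h : SeparatedPolyline (w t₀) M) :
    ∀ᶠ t in 𝓝 t₀, SeparatedPolyline (w t) M := by
  have hf : ∀ (f : Plane →L[ℝ] ℝ) m, ContinuousAt (fun t => f (w t m)) t₀ := fun f m =>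
    f.continuous.continuousAt.comp (hw m)
  have h1 : ∀ᶠ t in 𝓝 t₀, ∀ m ∈ Finset.range M, m + 1 < M →
      SeparatedAt (w t m) (w t (m + 1)) (w t (m + 2)) := by
    rw [Filter.eventually_all_finset]
    intro m _
    by_cases hm : m + 1 < M
    · obtain ⟨f, h1, h2⟩ := h.1 m hm
      filter_upwards [(hf f m).eventually_lt (hf f (m + 1)) h1,
        (hf f (m + 1)).eventually_lt (hf f (m + 2)) h2] with t ht ht' _
      exact ⟨f, ht, ht'⟩
    · exact Eventually.of_forall fun t h' => absurd h' hm
  have h2 : ∀ᶠ t in 𝓝 t₀, ∀ m ∈ Finset.range M, ∀ m' ∈ Finset.range M, m + 1 < m' →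
      StrictlySeparated (w t m) (w t (m + 1)) (w t m') (w t (m' + 1)) := by
    rw [Filter.eventually_all_finset]
    intro m _
    rw [Filter.eventually_all_finset]
    intro m' hm'
    by_cases hm : m + 1 < m'
    · obtain ⟨f, r, h1, h2, h3, h4⟩ := h.2 m m' hm (Finset.mem_range.1 hm')
      filter_upwards [(hf f m).eventually_lt continuousAt_const h1,
        (hf f (m + 1)).eventually_lt continuousAt_const h2,
        continuousAt_const.eventually_lt (hf f m') h3,
        continuousAt_const.eventually_lt (hf f (m' + 1)) h4] with t t1 t2 t3 t4 _
      exact ⟨f, r, t1, t2, t3, t4⟩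
    · exact Eventually.of_forall fun t h' => absurd h' hm
  filter_upwards [h1, h2] with t t1 t2
  exact ⟨fun m hm => t1 m (Finset.mem_range.2 (by omega)) hm, fun m m' hm hm' =>
    t2 m (Finset.mem_range.2 (by omega)) m' (Finset.mem_range.2 hm') hm⟩

lemma strictlySeparated_of_disjoint {a b c d : Plane}
    (h : Disjoint (segment ℝ a b) (segment ℝ c d)) : StrictlySeparated a b c d := by
  have hcomp : ∀ a b : Plane, IsCompact (segment ℝ a b) := fun a b => by
    rw [segment_eq_image_lineMap]
    exact isCompact_Icc.image AffineMap.lineMap_continuous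
  obtain ⟨f, u, v, h1, h2, h3⟩ := geometric_hahn_banach_compact_closed (convex_segment a b)
    (hcomp a b) (convex_segment c d) (hcomp c d).isClosed h
  exact ⟨f, u, h1 a (left_mem_segment ℝ a b), h1 b (right_mem_segment ℝ a b),
    h2.trans (h3 c (left_mem_segment ℝ c d)), h2.trans (h3 d (right_mem_segment ℝ c d))⟩

/-! ### Polylines made of arcs over a line -/

/-- The corners of the polyline that runs through the points `(s 0, y 0)`, `(s 1, y 1)`, … and has
between `(s i, y i)` and `(s (i + 1), y (i + 1))` one further corner, whose height is the square
of the width of the arc, on the side of the `x`-axis given by `ε i`. -/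
noncomputable def arcCorner (s y ε : ℕ → ℝ) (m : ℕ) : Plane :=
  if m % 2 = 0 then (s (m / 2), y (m / 2))
  else ((s (m / 2) + s (m / 2 + 1)) / 2, ε (m / 2) * (s (m / 2 + 1) - s (m / 2)) ^ 2)

lemma arcCorner_even (s y ε : ℕ → ℝ) (i : ℕ) : arcCorner s y ε (2 * i) = (s i, y i) := by
  simp [arcCorner]

lemma arcCorner_odd (s y ε : ℕ → ℝ) (i : ℕ) : arcCorner s y ε (2 * i + 1) =
    ((s i + s (i + 1)) / 2, ε i * (s (i + 1) - s i) ^ 2) := by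
  have h1 : (2 * i + 1) % 2 = 1 := by omega
  have h2 : (2 * i + 1) / 2 = i := by omega
  simp [arcCorner, h1, h2]

lemma mem_half_arc {p q ε : ℝ} {z : Plane}
    (hz : z ∈ segment ℝ ((p, 0) : Plane) ((p + q) / 2, ε * (q - p) ^ 2)) :
    ∃ t, 0 ≤ t ∧ t ≤ 1 ∧ z.1 = p + t * (q - p) / 2 ∧ z.2 = t * (ε * (q - p) ^ 2) := by
  obtain ⟨a, b, ha, hb, hab, rfl⟩ := hz
  obtain rfl : a = 1 - b := by linarith
  refine ⟨b, hb, by linarith, ?_, ?_⟩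
  · simp; ring
  · simp

lemma half_arc_base {p q ε : ℝ} (hpq : p ≠ q) (hε : ε ≠ 0) {z : Plane}
    (hz : z ∈ segment ℝ ((p, 0) : Plane) ((p + q) / 2, ε * (q - p) ^ 2)) (h0 : z.2 = 0) :
    z.1 = p := by
  obtain ⟨t, -, -, h1, h2⟩ := mem_half_arc hz
  have h3 : ε * (q - p) ^ 2 ≠ 0 := mul_ne_zero hε (pow_ne_zero 2 (sub_ne_zero.2 hpq.symm))
  have : t = 0 := by
    rw [h0] at h2
    rcases mul_eq_zero.1 h2.symm with h | h
    · exact h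
    · exact absurd h h3
  rw [h1, this]; ring

lemma half_arc_graph {p q ε : ℝ} (hε : ε * ε = 1) {z : Plane}
    (hz : z ∈ segment ℝ ((p, 0) : Plane) ((p + q) / 2, ε * (q - p) ^ 2)) :
    min p q ≤ z.1 ∧ z.1 ≤ max p q ∧
      ε * z.2 = 2 * (max p q - min p q) * min (z.1 - min p q) (max p q - z.1) := by
  obtain ⟨t, h0, h1, h2, h3⟩ := mem_half_arc hz
  have h4 : ε * z.2 = t * (q - p) ^ 2 := by rw [h3]; linear_combination t * (q - p) ^ 2 * hε
  rw [h4, h2]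
  rcases le_total p q with h | h
  · rw [min_eq_left h, max_eq_right h, min_eq_left (by nlinarith)]
    refine ⟨by nlinarith, by nlinarith, by ring⟩
  · rw [min_eq_right h, max_eq_left h, min_eq_right (by nlinarith)]
    refine ⟨by nlinarith, by nlinarith, by ring⟩

/-- Arcs of nested or non-overlapping intervals have no common point off the `x`-axis. -/
lemma arc_height_eq_zero {p q r s x : ℝ} (h : NonInterleaved p q r s) (hpq : p ≠ q) (hrs : r ≠ s)
    (hpr : p ≠ r) (hps : p ≠ s) (h1 : min p q ≤ x) (h2 : x ≤ max p q) (h3 : min r s ≤ x)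
    (h4 : x ≤ max r s)
    (he : 2 * (max p q - min p q) * min (x - min p q) (max p q - x) =
      2 * (max r s - min r s) * min (x - min r s) (max r s - x)) :
    2 * (max p q - min p q) * min (x - min p q) (max p q - x) = 0 := by
  have nested : ∀ a b c d : ℝ, a ≤ c → d ≤ b → (a ≠ c ∨ b ≠ d) → c ≤ x → x ≤ d →
      2 * (b - a) * min (x - a) (b - x) = 2 * (d - c) * min (x - c) (d - x) →
      2 * (d - c) * min (x - c) (d - x) = 0 := by
    intro a b c d hac hdb hne hcx hxd he
    have m1 : min (x - c) (d - x) ≤ min (x - a) (b - x) := min_le_min (by linarith) (by linarith)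
    have m2 : 0 ≤ min (x - c) (d - x) := le_min (by linarith) (by linarith)
    have m3 : d - c < b - a := by
      rcases hne with h | h
      · have := lt_of_le_of_ne hac h; linarith
      · have := lt_of_le_of_ne hdb (Ne.symm h); linarith
    have m4 : min (x - c) (d - x) = 0 := by nlinarith
    rw [m4, mul_zero]
  have hne : min p q ≠ min r s ∨ max p q ≠ max r s := by
    by_contra hcon
    push Not at hcon
    rcases le_total p q with h | h <;> rcases le_total r s with h' | h' <;>
      simp only [min_eq_left h, min_eq_right h, max_eq_left h, max_eq_right h, min_eq_left h',
        min_eq_right h', max_eq_left h', max_eq_right h'] at hcon <;>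
      first | exact hpr hcon.1 | exact hps hcon.1 | exact hpr hcon.2 | exact hps hcon.2
  have hlt : min p q < max p q := min_lt_max.2 hpq
  have hlt' : min r s < max r s := min_lt_max.2 hrs
  unfold NonInterleaved at h
  generalize min p q = a at *
  generalize max p q = b at *
  generalize min r s = c at *
  generalize max r s = d at *
  by_cases hbc : b ≤ c
  · have : x = b := by linarith
    subst this
    rw [min_eq_right (by linarith)]; ring
  by_cases hda : d ≤ a
  · have : x = a := by linarith
    subst this
    rw [min_eq_left (by linarith)]; ring
  push Not at hbc hda
  rcases lt_trichotomy a c with hac | hac | hac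
  · have hdb : d ≤ b := by
      by_contra hcon; exact h.1 ⟨hac, hbc, not_le.1 hcon⟩
    rw [he]
    exact nested a b c d hac.le hdb hne h3 h4 he
  · rcases le_total d b with hdb | hdb
    · rw [he]; exact nested a b c d hac.le hdb hne h3 h4 he
    · exact nested c d a b hac.ge hdb (by tauto) h1 h2 he.symm
  · have hdb : b ≤ d := by
      by_contra hcon; exact h.2 ⟨hac, hda, not_le.1 hcon⟩
    exact nested c d a b hac.le hdb (by tauto) h1 h2 he.symm

lemma exists_separating_functional {a b ε ε' : ℝ} (ha : a ≠ 0) (hb : b ≠ 0) (hab : a ≠ b)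
    (hε : ε = 1 ∨ ε = -1) (hε' : ε' = 1 ∨ ε' = -1) :
    ∃ α β : ℝ, α * (a / 2) + β * (ε * a ^ 2) < 0 ∧ 0 < α * (b / 2) + β * (ε' * b ^ 2) := by
  have ha2 : 0 < a ^ 2 := by positivity
  have hb2 : 0 < b ^ 2 := by positivity
  by_cases hee : ε = ε'
  · subst hee
    have hε2 : ε * ε = 1 := by rcases hε with rfl | rfl <;> norm_num
    have hab2 : 0 < (a - b) ^ 2 := by have := sub_ne_zero.2 hab; positivity
    rcases lt_or_gt_of_ne (mul_ne_zero ha hb) with h | h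
    · refine ⟨-a, 0, by nlinarith, by nlinarith⟩
    · refine ⟨a * (a - b) * (a + b), -a * (a - b) * ε, ?_, ?_⟩
      · have : a * (a - b) * (a + b) * (a / 2) + -a * (a - b) * ε * (ε * a ^ 2) =
            -(a ^ 2 * (a - b) ^ 2) / 2 := by
          linear_combination (-a ^ 3 * (a - b)) * hε2
        rw [this]
        have := mul_pos ha2 hab2
        linarith
      · have : a * (a - b) * (a + b) * (b / 2) + -a * (a - b) * ε * (ε * b ^ 2) =
            (a * b) * (a - b) ^ 2 / 2 := by
          linear_combination (-a * b ^ 2 * (a - b)) * hε2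
        rw [this]
        have := mul_pos h hab2
        linarith
  · refine ⟨0, ε', ?_, ?_⟩
    · rcases hε with rfl | rfl <;> rcases hε' with rfl | rfl <;>
        first | exact absurd rfl hee | linarith
    · rcases hε' with rfl | rfl <;> linarith

theorem separatedPolyline_arcCorner {s ε : ℕ → ℝ} {K : ℕ} (hε : ∀ i, ε i = 1 ∨ ε i = -1)
    (hinj : ∀ i ≤ K, ∀ j ≤ K, s i = s j → i = j)
    (hNC : ∀ i j, i < j → j < K → ε i = ε j →
      NonInterleaved (s i) (s (i + 1)) (s j) (s (j + 1))) :
    SeparatedPolyline (arcCorner s 0 ε) (2 * K) := by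
  have hne : ∀ i ≤ K, ∀ j ≤ K, i ≠ j → s i ≠ s j := fun i hi j hj hij h => hij (hinj i hi j hj h)
  have hε2 : ∀ i, ε i * ε i = 1 := fun i => by rcases hε i with h | h <;> rw [h] <;> norm_num
  have hε0 : ∀ i, ε i ≠ 0 := fun i => by rcases hε i with h | h <;> rw [h] <;> norm_num
  -- every segment is one of the two halves of an arc
  have hhalf : ∀ m, ∃ b o, b = (m + 1) / 2 ∧
      ((b = m / 2 ∧ o = m / 2 + 1) ∨ (b = m / 2 + 1 ∧ o = m / 2)) ∧
      segment ℝ (arcCorner s 0 ε m) (arcCorner s 0 ε (m + 1)) =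
        segment ℝ ((s b, 0) : Plane) ((s b + s o) / 2, ε (m / 2) * (s o - s b) ^ 2) := by
    intro m
    rcases Nat.even_or_odd' m with ⟨i, rfl | rfl⟩
    · have h2 : 2 * i / 2 = i := by omega
      refine ⟨i, i + 1, by omega, Or.inl ⟨h2.symm, by omega⟩, ?_⟩
      rw [arcCorner_even, arcCorner_odd, h2]; rfl
    · have h2 : (2 * i + 1) / 2 = i := by omega
      refine ⟨i + 1, i, by omega, Or.inr ⟨by omega, h2.symm⟩, ?_⟩
      rw [show 2 * i + 1 + 1 = 2 * (i + 1) by ring, arcCorner_even, arcCorner_odd,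
        segment_symm, h2, add_comm (s i), sub_sq_comm]; rfl
  refine ⟨fun m hm => ?_, fun m m' hm hm' => strictlySeparated_of_disjoint ?_⟩
  · -- consecutive segments, meeting at the top of an arc or at the common point of two arcs
    suffices h : ∃ α β : ℝ,
        α * (arcCorner s 0 ε m).1 + β * (arcCorner s 0 ε m).2 <
          α * (arcCorner s 0 ε (m + 1)).1 + β * (arcCorner s 0 ε (m + 1)).2 ∧
        α * (arcCorner s 0 ε (m + 1)).1 + β * (arcCorner s 0 ε (m + 1)).2 <
          α * (arcCorner s 0 ε (m + 2)).1 + β * (arcCorner s 0 ε (m + 2)).2 by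
      obtain ⟨α, β, h⟩ := h
      exact ⟨α • ContinuousLinearMap.fst ℝ ℝ ℝ + β • ContinuousLinearMap.snd ℝ ℝ ℝ, h⟩
    rcases Nat.even_or_odd' m with ⟨i, rfl | rfl⟩
    · have h1 := hne i (by omega) (i + 1) (by omega) (by omega)
      rw [show 2 * i + 2 = 2 * (i + 1) by ring, arcCorner_even, arcCorner_odd, arcCorner_even]
      simp only [Pi.zero_apply, mul_zero, add_zero]
      have h2 : 0 < (s (i + 1) - s i) ^ 2 := by
        have := sub_ne_zero.2 h1.symm; positivity
      exact ⟨s (i + 1) - s i, 0, by nlinarith, by nlinarith⟩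
    · have h1 := hne i (by omega) (i + 1) (by omega) (by omega)
      have h2 := hne (i + 2) (by omega) (i + 1) (by omega) (by omega)
      have h3 := hne i (by omega) (i + 2) (by omega) (by omega)
      obtain ⟨α, β, h4, h5⟩ := exists_separating_functional (sub_ne_zero.2 h1) (sub_ne_zero.2 h2)
        (fun h => h3 (sub_left_injective h)) (hε i) (hε (i + 1))
      rw [show 2 * i + 1 + 1 = 2 * (i + 1) by ring, show 2 * i + 1 + 2 = 2 * (i + 1) + 1 by ring,
        arcCorner_odd, arcCorner_even, arcCorner_odd]
      simp only [Pi.zero_apply, mul_zero, add_zero]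
      rw [show s (i + 1 + 1) = s (i + 2) from rfl]
      exact ⟨α, β, by nlinarith, by nlinarith⟩
  · rw [Set.disjoint_left]
    intro z hz hz'
    obtain ⟨b, o, hb, hbo, hseg⟩ := hhalf m
    obtain ⟨b', o', hb', hbo', hseg'⟩ := hhalf m'
    rw [hseg] at hz
    rw [hseg'] at hz'
    have hsbo : s b ≠ s o := hne b (by omega) o (by omega) (by omega)
    have hsbo' : s b' ≠ s o' := hne b' (by omega) o' (by omega) (by omega)
    obtain ⟨g1, g2, g3⟩ := half_arc_graph (hε2 _) hz
    obtain ⟨g1', g2', g3'⟩ := half_arc_graph (hε2 _) hz'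
    have hpos : ∀ {p q x : ℝ}, min p q ≤ x → x ≤ max p q →
        0 ≤ 2 * (max p q - min p q) * min (x - min p q) (max p q - x) := fun {p q x} h1 h2 =>
      mul_nonneg (by linarith) (le_min (by linarith) (by linarith))
    have hz2 : z.2 = 0 := by
      by_cases hee : ε (m / 2) = ε (m' / 2)
      · have hN := hNC (m / 2) (m' / 2) (by omega) (by omega) hee
        have hN' : NonInterleaved (s b) (s o) (s b') (s o') := by
          rcases hbo with ⟨h1, h2⟩ | ⟨h1, h2⟩ <;> rcases hbo' with ⟨h3, h4⟩ | ⟨h3, h4⟩ <;>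
            rw [h1, h2, h3, h4]
          · exact hN
          · exact nonInterleaved_swap_right.1 hN
          · exact nonInterleaved_swap_left.1 hN
          · exact nonInterleaved_swap_left.1 (nonInterleaved_swap_right.1 hN)
        rw [← hee] at g3'
        -- two different arcs have at most one common site
        have hshare : (b ≠ b' ∧ b ≠ o') ∨ (o ≠ b' ∧ o ≠ o') := by omega
        have h0 : ε (m / 2) * z.2 = 0 := by
          rw [g3]
          rcases hshare with ⟨h1, h2⟩ | ⟨h1, h2⟩
          · exact arc_height_eq_zero hN' hsbo hsbo' (hne b (by omega) b' (by omega) h1)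
              (hne b (by omega) o' (by omega) h2) g1 g2 g1' g2' (g3.symm.trans g3')
          · rw [min_comm (s b) (s o)] at g1
            rw [max_comm (s b) (s o)] at g2
            rw [min_comm (s b) (s o), max_comm (s b) (s o)] at g3 ⊢
            exact arc_height_eq_zero (nonInterleaved_swap_left.1 hN') hsbo.symm hsbo'
              (hne o (by omega) b' (by omega) h1) (hne o (by omega) o' (by omega) h2) g1 g2 g1' g2'
              (g3.symm.trans g3')
        exact (mul_eq_zero.1 h0).resolve_left (hε0 _)
      · have p1 := hpos g1 g2
        have p2 := hpos g1' g2'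
        rw [← g3] at p1
        rw [← g3'] at p2
        rcases hε (m / 2) with h1 | h1 <;> rcases hε (m' / 2) with h2 | h2 <;>
          rw [h1] at p1 hee <;> rw [h2] at p2 hee <;>
          first | exact absurd rfl hee | linarith
    have e1 := half_arc_base hsbo (hε0 _) hz hz2
    have e2 := half_arc_base hsbo' (hε0 _) hz' hz2
    have := hinj b (by omega) b' (by omega) (e1.symm.trans e2)
    omega

/-! ### Drawings from separated polylines -/

/-- The part of the polyline with corners `w` that has the corners `w (6 * i)` to
`w (6 * i + 6)`. -/
def sixSegments (w : ℕ → Plane) (i : ℕ) : Polyline where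
  source := w (6 * i)
  bends := [w (6 * i + 1), w (6 * i + 2), w (6 * i + 3), w (6 * i + 4), w (6 * i + 5)]
  target := w (6 * i + 6)

lemma sixSegments_getElem (w : ℕ → Plane) (i j : ℕ) (hj : j < (sixSegments w i).corners.length) :
    (sixSegments w i).corners[j] = w (6 * i + j) := by
  have hj' : j < 7 := hj
  interval_cases j <;> rfl

lemma sixSegments_seg (w : ℕ → Plane) (i j : ℕ)
    (hj : j + 1 < (sixSegments w i).corners.length) :
    (sixSegments w i).seg j hj = segment ℝ (w (6 * i + j)) (w (6 * i + j + 1)) := by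
  unfold Polyline.seg
  rw [sixSegments_getElem, sixSegments_getElem]
  rfl

lemma mem_carrier_sixSegments {w : ℕ → Plane} {i : ℕ} {x : Plane}
    (hx : x ∈ (sixSegments w i).carrier) :
    ∃ m, 6 * i ≤ m ∧ m < 6 * i + 6 ∧ x ∈ segment ℝ (w m) (w (m + 1)) := by
  obtain ⟨j, hj, hx⟩ := hx
  rw [sixSegments_seg] at hx
  have hj' : j + 1 < 7 := hj
  exact ⟨6 * i + j, by omega, by omega, hx⟩

lemma SeparatedPolyline.isSimple {w : ℕ → Plane} {M : ℕ} (h : SeparatedPolyline w M) {i : ℕ}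
    (hi : 6 * i + 6 ≤ M) : (sixSegments w i).IsSimple := by
  refine ⟨fun j hj => ?_, fun j k hj hk hjk x hx hx' => ?_⟩
  · rw [sixSegments_getElem, sixSegments_getElem]
    have hj' : j + 1 < 7 := hj
    exact h.ne (by omega) (by omega)
  · rw [sixSegments_seg] at hx hx'
    rw [sixSegments_getElem]
    have hk' : k + 1 < 7 := hk
    obtain ⟨h1, h2⟩ := h.inter (by omega) (by omega) hx hx'
    exact ⟨by omega, h2⟩

/-- A corner lies on no segments but the one or two which it bounds. -/
lemma SeparatedPolyline.corner_mem {w : ℕ → Plane} {M : ℕ} (h : SeparatedPolyline w M) (hM : 2 ≤ M)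
    {m m' : ℕ} (hm : m ≤ M) (hm' : m' < M) (hx : w m ∈ segment ℝ (w m') (w (m' + 1))) :
    m = m' ∨ m = m' + 1 := by
  by_contra hcon
  push Not at hcon
  rcases Nat.lt_or_ge m' m with hlt | hge
  · -- the segment that ends in the corner meets no earlier segment in it
    obtain ⟨k, rfl⟩ : ∃ k, m = k + 1 := ⟨m - 1, by omega⟩
    obtain ⟨-, h2⟩ := h.inter (m := m') (m' := k) (by omega) (by omega) hx (right_mem_segment _ _ _)
    exact h.ne hM (by omega) h2.symm
  · obtain ⟨h1, h2⟩ := h.inter (m := m) (m' := m') (by omega) (by omega) (left_mem_segment _ _ _) hx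
    rw [h1] at h2
    exact h.ne hM (by omega) h2

/-- A separated polyline with six segments for every edge is a drawing of a path in which every
edge has five bends. The first `6 * k` segments do not belong to the drawing. -/
theorem SeparatedPolyline.exists_drawing {V : Type*} {G : SimpleGraph V} {n : ℕ}
    (φ : SimpleGraph.pathGraph n ≃g G) {w : ℕ → Plane} {M k : ℕ} (h : SeparatedPolyline w M)
    (hM : 6 * (n + k) ≤ M + 6) (hinj : ∀ i j : Fin n, w (6 * (i + k)) = w (6 * (j + k)) → i = j) :
    ∃ D : PlanarPolylineDrawing G, (∀ i, D.pos (φ i) = w (6 * (i + k))) ∧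
      D.curveComplexity ≤ 5 := by
  have hedge : ∀ e : G.edgeSet, ∃ (i : ℕ) (h0 : i < n) (h1 : i + 1 < n),
      (e : Sym2 V) = s(φ ⟨i, h0⟩, φ ⟨i + 1, h1⟩) := by
    rintro ⟨e, he⟩
    induction e using Sym2.ind with
    | _ u v =>
    have h1 : (SimpleGraph.pathGraph n).Adj (φ.symm u) (φ.symm v) :=
      φ.symm.map_adj_iff.2 (G.mem_edgeSet.1 he)
    rw [SimpleGraph.pathGraph_adj] at h1
    rcases h1 with h1 | h1
    · refine ⟨φ.symm u, (φ.symm u).2, by rw [h1]; exact (φ.symm v).2, ?_⟩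
      have h2 : (⟨φ.symm u + 1, by rw [h1]; exact (φ.symm v).2⟩ : Fin n) = φ.symm v := Fin.ext h1
      simp [h2]
    · refine ⟨φ.symm v, (φ.symm v).2, by rw [h1]; exact (φ.symm u).2, ?_⟩
      have h2 : (⟨φ.symm v + 1, by rw [h1]; exact (φ.symm u).2⟩ : Fin n) = φ.symm u := Fin.ext h1
      simp [h2, Sym2.eq_swap]
  choose I hI0 hI1 hI using hedge
  have hIinj : ∀ e f, I e = I f → e = f := fun e f hef => by
    apply Subtype.ext
    rw [hI e, hI f]
    simp only [hef]
  have hmem : ∀ (e : G.edgeSet) (i : Fin n), ((i : ℕ) = I e ∨ (i : ℕ) = I e + 1) →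
      φ i ∈ (e : Sym2 V) := fun e i hi => by
    rw [hI e]
    rcases hi with hi | hi
    · rw [show i = ⟨I e, hI0 e⟩ from Fin.ext hi]; exact Sym2.mem_mk_left _ _
    · rw [show i = ⟨I e + 1, hI1 e⟩ from Fin.ext hi]; exact Sym2.mem_mk_right _ _
  refine ⟨{ pos := fun v => w (6 * (φ.symm v + k))
            curve := fun e => sixSegments w (I e + k)
            pos_injective := fun u v huv => φ.symm.injective (hinj _ _ huv)
            curve_ends := fun e => ⟨_, _, hI e, ?_, ?_⟩
            curve_simple := fun e => h.isSimple (by have := hI1 e; omega)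
            mem_of_pos_mem_carrier := fun e v hv => ?_
            inter := ?_ }, fun i => ?_, ?_⟩
  · simp [sixSegments]
  · simp [sixSegments, show 6 * (I e + 1 + k) = 6 * (I e + k) + 6 by ring]
  · obtain ⟨m, hm1, hm2, hm3⟩ := mem_carrier_sixSegments hv
    have := hI1 e
    have := (φ.symm v).2
    have h3 := h.corner_mem (by omega) (by omega) (by omega) hm3
    have := hmem e (φ.symm v) (by omega)
    rwa [φ.apply_symm_apply] at this
  · have aux : ∀ e f : G.edgeSet, I e < I f → ∀ x ∈ (sixSegments w (I e + k)).carrier,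
        x ∈ (sixSegments w (I f + k)).carrier →
        ∃ v : V, v ∈ (e : Sym2 V) ∧ v ∈ (f : Sym2 V) ∧ x = w (6 * (φ.symm v + k)) := by
      intro e f hef x hx hx'
      obtain ⟨m, hm1, hm2, hm3⟩ := mem_carrier_sixSegments hx
      obtain ⟨m', hm1', hm2', hm3'⟩ := mem_carrier_sixSegments hx'
      have := hI1 f
      obtain ⟨h1, h2⟩ := h.inter (by omega) (by omega) hm3 hm3'
      refine ⟨φ ⟨I f, hI0 f⟩, hmem _ _ (Or.inr ?_), hmem _ _ (Or.inl rfl), ?_⟩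
      · simp only; omega
      · rw [h2, φ.symm_apply_apply]
        congr 1; simp only; omega
    intro e f hef x hx hx'
    rcases lt_trichotomy (I e) (I f) with h1 | h1 | h1
    · exact aux e f h1 x hx hx'
    · exact absurd (hIinj e f h1) hef
    · obtain ⟨v, a, b, c⟩ := aux f e h1 x hx' hx
      exact ⟨v, b, a, c⟩
  · simp
  · refine iSup_le fun e => ?_
    show ((5 : ℕ) : ℕ∞) ≤ 5
    norm_num

/-! ### Colored words and sorted points -/

/-- The word `0, f 0, f 1, …, f (n - 1), 0, 0, …`. -/
def paddedWord {n : ℕ} (f : Fin n → Fin 3) : ℕ → Fin 3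
  | 0 => 0
  | i + 1 => if h : i < n then f ⟨i, h⟩ else 0

lemma paddedWord_succ {n : ℕ} (f : Fin n → Fin 3) (i : Fin n) : paddedWord f (i + 1) = f i := by
  simp [paddedWord]

lemma paddedWord_of_le {n : ℕ} (f : Fin n → Fin 3) {i : ℕ} (hi : n + 1 ≤ i) :
    paddedWord f i = 0 := by
  obtain ⟨k, rfl⟩ : ∃ k, i = k + 1 := ⟨i - 1, by omega⟩
  have : ¬ k < n := by omega
  simp [paddedWord, this]

lemma card_filter_paddedWord {n : ℕ} (f : Fin n → Fin 3) (x : Fin 3) :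
    ((Finset.range (n + 1)).filter fun i => paddedWord f i = x).card =
      (Finset.univ.filter fun i => f i = x).card + if (0 : Fin 3) = x then 1 else 0 := by
  rw [Finset.card_filter, Finset.card_filter, Finset.sum_range_succ', Finset.sum_range]
  simp only [paddedWord_succ]
  rfl

/-- Some linear functional takes distinct values on finitely many points. -/
lemma exists_generic_slope (P : Finset Plane) :
    ∃ θ : ℝ, Set.InjOn (fun p : Plane => p.1 + θ * p.2) P := by
  obtain ⟨θ, hθ⟩ := ((P ×ˢ P).image fun pq : Plane × Plane =>
    -(pq.1.1 - pq.2.1) / (pq.1.2 - pq.2.2)).finite_toSet.exists_notMem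
  refine ⟨θ, fun p hp q hq hpq => ?_⟩
  simp only at hpq
  by_cases h : p.2 = q.2
  · exact Prod.ext (by rw [h] at hpq; linarith) h
  · refine absurd ?_ hθ
    simp only [Finset.coe_image, Set.mem_image, Finset.mem_coe, Finset.mem_product]
    refine ⟨(p, q), ⟨hp, hq⟩, ?_⟩
    rw [div_eq_iff (sub_ne_zero.2 h)]
    linarith

lemma exists_sorted_enumeration {P : Finset Plane} {n : ℕ} (hn : P.card = n) {h : Plane → ℝ}
    (hinj : Set.InjOn h P) :
    ∃ p : Fin n → P, Function.Bijective p ∧ StrictMono fun j => h (p j) := by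
  have hcard : (P.image h).card = n := by rw [Finset.card_image_of_injOn hinj, hn]
  have hex : ∀ j, ∃ p : P, h p = (P.image h).orderEmbOfFin hcard j := fun j => by
    obtain ⟨p, hp, hp'⟩ := Finset.mem_image.1 ((P.image h).orderEmbOfFin_mem hcard j)
    exact ⟨⟨p, hp⟩, hp'⟩
  choose p hp using hex
  have hmono : StrictMono fun j => h (p j) := by
    simp only [hp]
    exact ((P.image h).orderEmbOfFin hcard).strictMono
  refine ⟨p, (Fintype.bijective_iff_injective_and_card p).2 ⟨fun i j hij => ?_, by simp [hn]⟩,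
    hmono⟩
  exact hmono.injective (by simp only [hij])

end PointSetEmbedding

open Filter Topology PointSetEmbedding

/-! ### The embedding -/

theorem mainTheorem4 {V : Type*} [Fintype V] (G : SimpleGraph V)
    (hG : PointSetEmbedding.IsPathGraph G) (c : V → Fin 3)
    (S : PointSetEmbedding.ColoredPointSet 3) (hS : S.Compatible c) :
    ∃ D : PointSetEmbedding.PlanarPolylineDrawing G,
      D.IsColoredEmbedding c S ∧ D.curveComplexity ≤ 5 := by
  classical
  obtain ⟨n, ⟨φ⟩⟩ := hG
  have hVn : Fintype.card V = n := by
    rw [← Fintype.card_congr φ.toEquiv, Fintype.card_fin]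
  have hSn : S.points.card = n := by
    rw [← hVn, ← Fintype.card_coe, ← Finset.card_univ, ← Finset.card_univ,
      Finset.card_eq_sum_card_fiberwise (f := S.col) (t := Finset.univ) (by simp),
      Finset.card_eq_sum_card_fiberwise (f := c) (t := Finset.univ) (by simp)]
    exact Finset.sum_congr rfl fun i _ => hS i
  obtain ⟨θ, hθ⟩ := exists_generic_slope S.points
  obtain ⟨p, hp, hpmono⟩ := exists_sorted_enumeration hSn hθ
  obtain ⟨X, hX, hXp⟩ := exists_strictMono_extension hpmono 2
  set c' := paddedWord fun i => c (φ i) with hc'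
  set σ' := paddedWord fun j => S.col (p j) with hσ'
  have hcount : ∀ x, ((Finset.range (n + 1)).filter fun i => c' i = x).card =
      ((Finset.range (n + 1)).filter fun j => σ' j = x).card := by
    intro x
    rw [card_filter_paddedWord, card_filter_paddedWord]
    congr 1
    rw [Finset.card_filter, Finset.card_filter]
    have h1 := hS x
    rw [Finset.card_filter, Finset.card_filter] at h1
    rw [φ.bijective.sum_comp fun v => if c v = x then 1 else 0,
      hp.sum_comp fun q => if S.col q = x then 1 else 0]
    exact h1.symm
  -- the letter in front of the words stands for a point left of all others, where the path starts
  obtain ⟨D, π, t, pg, hD, hπ, hπinj, hπ0, ht, htinj, hNC⟩ :=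
    exists_nonInterleaved_sites (n := n + 1) (c := c') (σ := σ') (by simp [hc', paddedWord])
      (fun i hi => by rw [hc', paddedWord_of_le _ hi]; decide)
      (fun i hi => by rw [hσ', paddedWord_of_le _ hi]; decide) hcount
  obtain ⟨Y, hY, hYX⟩ := exists_strictMono_interpolation hX hD
  -- the point that is assigned to a vertex
  have hpoint : ∀ i : Fin n, ∃ j : Fin n, π (i + 1) = j + 1 := fun i => by
    have h1 := hπ (i + 1) (by omega)
    have h2 : π (i + 1) ≠ 0 := fun h => by
      have := hπinj (i + 1) (by omega) 0 (by omega) (by rw [h, hπ0 (by omega) rfl])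
      omega
    exact ⟨⟨π (i + 1) - 1, by omega⟩, by simp only; omega⟩
  choose j hj using hpoint
  have hjcol : ∀ i, S.col (p (j i)) = c (φ i) := fun i => by
    have h1 := (hπ (i + 1) (by omega)).2
    rw [hj i, hσ', hc', paddedWord_succ, paddedWord_succ] at h1
    exact h1
  have hjinj : Function.Injective j := fun i k hik => by
    have := hπinj (i + 1) (by omega) (k + 1) (by omega) (by rw [hj i, hj k, hik])
    exact Fin.ext (by omega)
  set y : ℕ → ℝ := fun m => if h : m / 3 - 1 < n then
    (if m % 3 = 0 then (p (j ⟨m / 3 - 1, h⟩) : Plane).2 else 0) else 0 with hy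
  have hyi : ∀ i : Fin n, y (3 * (i + 1)) = (p (j i) : Plane).2 := fun i => by
    have h2 : 3 * ((i : ℕ) + 1) % 3 = 0 := by omega
    simp [hy, h2]
  set s : ℕ → ℝ := fun m => Y (t m) with hs
  have hsi : ∀ i : Fin n, s (3 * (i + 1)) = (p (j i) : Plane).1 + θ * (p (j i) : Plane).2 :=
    fun i => by
      simp only [hs]
      rw [ht, hj, ← Nat.mul_succ, hYX]
      exact hXp (j i)
  set ε : ℕ → ℝ := fun m => if pg m then -1 else 1 with hεdef
  have hε : ∀ i, ε i = 1 ∨ ε i = -1 := fun i => by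
    simp only [hεdef]; split_ifs <;> simp
  have hεpg : ∀ i k, ε i = ε k → (pg i ↔ pg k) := fun i k h => by
    simp only [hεdef] at h
    by_cases h1 : pg i <;> by_cases h2 : pg k <;> simp [h1, h2] at h ⊢ <;> norm_num at h
  have hsep := separatedPolyline_arcCorner (s := s) (K := 3 * n) hε
    (fun i hi k hk h => htinj i (by omega) k (by omega) (hY.injective h))
    (fun i k hik hk h => (hNC i k hik (by omega) (hεpg i k h)).map_strictMono hY)
  -- for small `r` the drawing survives if the heights of the points are multiplied by `r`
  have hev := SeparatedPolyline.eventually (w := fun r => arcCorner s (r • y) ε) (t₀ := 0)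
    (M := 2 * (3 * n)) (fun m => by
      unfold arcCorner
      split_ifs
      · simp only [Pi.smul_apply, smul_eq_mul]
        fun_prop
      · fun_prop) (by rw [zero_smul]; exact hsep)
  obtain ⟨r, hr, hr0⟩ := ((hev.filter_mono nhdsWithin_le_nhds).and
    (self_mem_nhdsWithin : Set.Ioi (0 : ℝ) ∈ 𝓝[>] 0)).exists
  have hr0' : r ≠ 0 := ne_of_gt hr0
  -- undo the linear map `(x, y) ↦ (x + θ * y, r * y)`
  set w : ℕ → Plane := fun m => ((arcCorner s (r • y) ε m).1 -
    θ * ((arcCorner s (r • y) ε m).2 / r), (arcCorner s (r • y) ε m).2 / r) with hw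
  have hwsep : SeparatedPolyline w (2 * (3 * n)) := by
    refine SeparatedPolyline.of_comp ((ContinuousLinearMap.fst ℝ ℝ ℝ +
      θ • ContinuousLinearMap.snd ℝ ℝ ℝ).prod (r • ContinuousLinearMap.snd ℝ ℝ ℝ)) ?_
    convert hr using 2 with m
    refine Prod.ext ?_ ?_
    · simp [hw]
    · simp [hw, mul_div_cancel₀ _ hr0']
  have hwi : ∀ i : Fin n, w (6 * (i + 1)) = p (j i) := fun i => by
    simp only [hw]
    rw [show 6 * ((i : ℕ) + 1) = 2 * (3 * (i + 1)) by ring, arcCorner_even, hsi]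
    simp only [Pi.smul_apply, smul_eq_mul, hyi, mul_div_cancel_left₀ _ hr0']
    exact Prod.ext (by simp) rfl
  obtain ⟨Dr, hDr, hcc⟩ := hwsep.exists_drawing φ (k := 1) (by omega) (fun i k h => by
    rw [hwi, hwi] at h
    exact hjinj (hp.1 (Subtype.ext h)))
  refine ⟨Dr, fun v => ?_, hcc⟩
  obtain ⟨i, rfl⟩ := φ.surjective v
  rw [hDr, hwi]
  exact ⟨(p (j i)).2, hjcol i⟩
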